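/- A quiver $Q$ is a finite directed graph, multiple arrows allowed, without loops and directed $2$-cycles; $\operatorname{Vert}(Q)$ is its set of vertices. It is *bipartite*, with bipartition $\epsilon:\operatorname{Vert}(Q)\to\{0,1\}$, if $\epsilon_u\neq\epsilon_v$ for every arrow $u\to v$. The mutation of $Q$ at $v$ adds an arrow $u\to w$ for each pair of arrows $u\to v$, $v\to w$, reverses all arrows at $v$, and then cancels directed $2$-cycles. A bipartite quiver is *recurrent* if the combined mutation at all vertices with $\epsilon_v=1$, and likewise the combined mutation at all vertices with $\epsilon_v=0$, reverses all arrows of $Q$ and has no other effect. The (birational) $T$-system of $Q$ is the family $T_v(t)\in\mathbb{Q}(\mathbf{x})$, $\mathbf{x}=\{x_v\}_{v\in\operatorname{Vert}(Q)}$, defined for $v\in\operatorname{Vert}(Q)$ and $t\in\mathbb{Z}$ with $t+\epsilon_v$ even, with $T_v(\epsilon_v)=x_v$ and $$T_v(t+1)T_v(t-1)=\prod_{u\to v}T_u(t)+\prod_{v\to w}T_w(t)\qquad (t+1+\epsilon_v\text{ even}).$$ For $\lambda:\operatorname{Vert}(Q)\to\mathbb{R}$, the tropical $T$-system $\mathfrak{t}^\lambda$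 is the family $\mathfrak{t}^\lambda_v(t)\in\mathbb{R}$, with the same index set, with $\mathfrak{t}^\lambda_v(\epsilon_v)=\lambda(v)$ and $$\mathfrak{t}^\lambda_v(t+1)+\mathfrak{t}^\lambda_v(t-1)=\max\Big(\sum_{u\to v}\mathfrak{t}^\lambda_u(t),\ \sum_{v\to w}\mathfrak{t}^\lambda_w(t)\Big)\qquad (t+1+\epsilon_v\text{ even}).$$ All products and sums are over arrows. Let $\delta_u(v)=1$ if $u=v$ and $\delta_u(v)=0$ otherwise. A *fixed point* of $Q$ is a map $\rho:\operatorname{Vert}(Q)\to\mathbb{R}_{>1}$ with $\rho(v)^2=\prod_{u\to v}\rho(u)+\prod_{v\to w}\rho(w)$ for all $v$. **Proposition.** Let $Q$ be a bipartite recurrent quiver and $N$ an integer. The following are equivalent: 1. $\mathfrak{t}^{\delta_u}_v(\epsilon_v+2N)=\mathfrak{t}^{\delta_u}_v(\epsilon_v)$ for all $u,v\in\operatorname{Vert}(Q)$; 2. $\mathfrak{t}^{\lambda}_v(t+2N)=\mathfrak{t}^{\lambda}_v(t)$ for all $\lambda:\operatorname{Vert}(Q)\to\mathbb{R}$ and all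 $v\in\operatorname{Vert}(Q)$, $t\in\mathbb{Z}$ with $t+\epsilon_v$ even; 3. there is a map $c:\operatorname{Vert}(Q)\to\mathbb{R}_{>0}$ such that $T_v(t+2N)=c(v)\,T_v(t)$ (in $\mathbb{R}(\mathbf{x})$) for all $v\in\operatorname{Vert}(Q)$, $t\in\mathbb{Z}$ with $t+\epsilon_v$ even. If these conditions hold and $Q$ has a fixed point, then any map $c$ as in (3) satisfies $c(v)=1$ for all $v$. -/

import Mathlib

/-- A finite-multiplicity quiver on the vertex set `V`, without loops and without directed
2-cycles; `arrows u v` is the number of arrows `u → v` (multiple arrows are allowed). -/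
@[ext]
structure ClusterQuiver (V : Type*) where
  arrows : V → V → ℕ
  no_loop : ∀ v, arrows v v = 0
  no_two_cycle : ∀ u v, arrows u v = 0 ∨ arrows v u = 0

namespace ClusterQuiver

variable {V : Type*}

/-- The quiver with all arrows reversed. -/
def reverse (Q : ClusterQuiver V) : ClusterQuiver V where
  arrows u v := Q.arrows v u
  no_loop := Q.no_loop
  no_two_cycle u v := Q.no_two_cycle v u

/-- Quiver mutation at `v`: for each pair of arrows `u → v`, `v → w` add an arrow `u → w`;
reverse all arrows at `v`; cancel directed 2-cycles as long as there are any.  (The truncated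
subtraction of natural numbers is exactly this cancellation.) -/
def mutate [DecidableEq V] (Q : ClusterQuiver V) (v : V) : ClusterQuiver V where
  arrows u w :=
    if u = v ∨ w = v then Q.arrows w u
    else (Q.arrows u w + Q.arrows u v * Q.arrows v w)
          - (Q.arrows w u + Q.arrows w v * Q.arrows v u)
  no_loop u := by
    by_cases h : u = v
    · simp [h, Q.no_loop]
    · simp [h]
  no_two_cycle u w := by
    by_cases h : u = v ∨ w = v
    · have h' : w = v ∨ u = v := h.symm
      simp only [h, h', if_true]
      exact Q.no_two_cycle w u
    · have h' : ¬ (w = v ∨ u = v) := fun k => h k.symm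
      simp only [h, h', if_false]
      omega

/-- The successive mutation at all vertices of a finite set, one after the other.  It is only used
for sets of pairwise non-adjacent vertices, where the order is irrelevant. -/
noncomputable def mutateSet [DecidableEq V] (Q : ClusterQuiver V) (s : Finset V) :
    ClusterQuiver V :=
  s.toList.foldl mutate Q

/-- A bipartition of `Q`: the two ends of every arrow have different colours.  A vertex `v` is
black if `ε v = 1` and white if `ε v = 0`. -/
def IsBipartition (Q : ClusterQuiver V) (ε : V → Fin 2) : Prop :=
  ∀ u v, Q.arrows u v ≠ 0 → ε u ≠ ε v

/-- `Q`, with the bipartition `ε`, is recurrent: the combined mutation at all black vertices, as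
well as the one at all white vertices, reverses all arrows and has no other effect. -/
def IsRecurrent [Fintype V] [DecidableEq V] (Q : ClusterQuiver V) (ε : V → Fin 2) : Prop :=
  Q.mutateSet (Finset.univ.filter fun v => ε v = 1) = Q.reverse ∧
  Q.mutateSet (Finset.univ.filter fun v => ε v = 0) = Q.reverse

/-- The integer `ε_v ∈ {0, 1}`. -/
def eps (ε : V → Fin 2) (v : V) : ℤ := ((ε v : ℕ) : ℤ)

/-! ### The bipartite dynamics

A recurrence expressing the pair of consecutive values at `v` through the values at the neighbours
is run on labelings of `V`.  The labeling at time `t` holds at `v` the value with time index `t` if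
`t + ε_v` is even, and with time index `t + 1` if `t + ε_v` is odd.  Passing from time `t` to
time `t + 1`, or back, exchanges the labels of the vertices with `t + ε_v` even, using the map
`upd`, which computes a new label at a vertex from the old labeling. -/

section Dynamics

variable {X : Type*}

/-- The labeling at time `n ≥ 0`. -/
def forwardLabel (ε : V → Fin 2) (upd : (V → X) → V → X) (x : V → X) : ℕ → V → X
  | 0 => x
  | n + 1 => fun v =>
      if Even ((n : ℤ) + eps ε v) then upd (forwardLabel ε upd x n) v
      else forwardLabel ε upd x n v

/-- The labeling at time `-n ≤ 0`. -/
def backwardLabel (ε : V → Fin 2) (upd : (V → X) → V → X) (x : V → X) : ℕ → V → X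
  | 0 => x
  | n + 1 => fun v =>
      if Even (-((n : ℤ) + 1) + eps ε v) then upd (backwardLabel ε upd x n) v
      else backwardLabel ε upd x n v

/-- The labeling at time `t`. -/
def labelAt (ε : V → Fin 2) (upd : (V → X) → V → X) (x : V → X) : ℤ → V → X
  | Int.ofNat n => forwardLabel ε upd x n
  | Int.negSucc n => backwardLabel ε upd x (n + 1)

theorem labelAt_neg (ε : V → Fin 2) (upd : (V → X) → V → X) (x : V → X) (n : ℕ) :
    labelAt ε upd x (-(n : ℤ)) = backwardLabel ε upd x n := by
  cases n with
  | zero => rfl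
  | succ n => rfl

theorem labelAt_step (ε : V → Fin 2) (upd : (V → X) → V → X) (x : V → X) (t : ℤ) :
    (∀ v, ¬ Even (t + eps ε v) → labelAt ε upd x (t + 1) v = labelAt ε upd x t v) ∧
    ((∀ v, Even (t + eps ε v) → labelAt ε upd x (t + 1) v = upd (labelAt ε upd x t) v) ∨
     (∀ v, Even (t + eps ε v) → labelAt ε upd x t v = upd (labelAt ε upd x (t + 1)) v)) := by
  rcases t with n | n
  · have h1 : labelAt ε upd x (Int.ofNat n + 1) = forwardLabel ε upd x (n + 1) := rfl
    have h0 : labelAt ε upd x (Int.ofNat n) = forwardLabel ε upd x n := rfl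
    rw [h1, h0]
    refine ⟨fun v hv => ?_, Or.inl fun v hv => ?_⟩
    · exact if_neg hv
    · exact if_pos hv
  · have e : Int.negSucc n + 1 = -(n : ℤ) := by omega
    have e' : Int.negSucc n = -((n : ℤ) + 1) := by omega
    have h1 : labelAt ε upd x (Int.negSucc n + 1) = backwardLabel ε upd x n := by
      rw [e, labelAt_neg]
    have h0 : labelAt ε upd x (Int.negSucc n) = backwardLabel ε upd x (n + 1) := rfl
    rw [h1, h0, e']
    refine ⟨fun v hv => ?_, Or.inr fun v hv => ?_⟩
    · exact (if_neg hv).symm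
    · exact if_pos hv

/-- The initial condition: the value at `v` with time index `ε_v` is the given one. -/
theorem labelAt_init (ε : V → Fin 2) (upd : (V → X) → V → X) (x : V → X) (v : V) :
    labelAt ε upd x (eps ε v) v = x v := by
  rcases h : ε v with ⟨k, hk⟩
  have hs : eps ε v = (k : ℤ) := by simp [eps, h]
  rw [hs]
  have hk' : k = 0 ∨ k = 1 := by omega
  rcases hk' with rfl | rfl
  · rfl
  · have h1 : labelAt ε upd x ((1 : ℕ) : ℤ) = forwardLabel ε upd x (0 + 1) := rfl
    rw [h1]
    refine (if_neg ?_).trans rfl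
    rw [hs]
    decide

end Dynamics

variable [Fintype V]

/-- The right-hand side of the T-system relation at `v`:
`∏_{u → v} L u + ∏_{v → w} L w`, the products being over arrows. -/
def exchange (Q : ClusterQuiver V) {K : Type*} [CommSemiring K] (L : V → K) (v : V) : K :=
  ∏ u, L u ^ Q.arrows u v + ∏ w, L w ^ Q.arrows v w

/-- The right-hand side of the tropical T-system relation at `v`:
`max (∑_{u → v} L u) (∑_{v → w} L w)`, the sums being over arrows. -/
def tropicalExchange (Q : ClusterQuiver V) (L : V → ℝ) (v : V) : ℝ :=
  max (∑ u, (Q.arrows u v : ℝ) * L u) (∑ w, (Q.arrows v w : ℝ) * L w)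

theorem exchange_congr {Q : ClusterQuiver V} {K : Type*} [CommSemiring K] {L L' : V → K} {v : V}
    (h1 : ∀ u, Q.arrows u v ≠ 0 → L u = L' u) (h2 : ∀ u, Q.arrows v u ≠ 0 → L u = L' u) :
    Q.exchange L v = Q.exchange L' v := by
  unfold exchange
  congr 1
  · refine Finset.prod_congr rfl fun u _ => ?_
    by_cases h : Q.arrows u v = 0
    · simp [h]
    · rw [h1 u h]
  · refine Finset.prod_congr rfl fun u _ => ?_
    by_cases h : Q.arrows v u = 0
    · simp [h]
    · rw [h2 u h]

theorem tropicalExchange_congr {Q : ClusterQuiver V} {L L' : V → ℝ} {v : V}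
    (h1 : ∀ u, Q.arrows u v ≠ 0 → L u = L' u) (h2 : ∀ u, Q.arrows v u ≠ 0 → L u = L' u) :
    Q.tropicalExchange L v = Q.tropicalExchange L' v := by
  unfold tropicalExchange
  congr 1
  · refine Finset.sum_congr rfl fun u _ => ?_
    by_cases h : Q.arrows u v = 0
    · simp [h]
    · rw [h1 u h]
  · refine Finset.sum_congr rfl fun u _ => ?_
    by_cases h : Q.arrows v u = 0
    · simp [h]
    · rw [h2 u h]

/-- The field of rational functions over `k` in indeterminates indexed by `V`. -/
abbrev RatFun (k V : Type*) [Field k] : Type _ := FractionRing (MvPolynomial V k)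

/-- The indeterminate `x_v` in the field of rational functions over `ℚ`. -/
noncomputable def indet (v : V) : RatFun ℚ V :=
  algebraMap (MvPolynomial V ℚ) (RatFun ℚ V) (MvPolynomial.X v)

/-- The (birational) T-system: `Q.tSystem ε v t` is `T_v(t) ∈ ℚ(x)`, for `t + ε_v` even
(the value for `t + ε_v` odd has no meaning). -/
noncomputable def tSystem (Q : ClusterQuiver V) (ε : V → Fin 2) (v : V) (t : ℤ) : RatFun ℚ V :=
  labelAt ε (fun L v => Q.exchange L v / L v) indet t v

/-- The tropical T-system with initial data `l`, for `t + ε_v` even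
(the value for `t + ε_v` odd has no meaning). -/
noncomputable def tropicalTSystem (Q : ClusterQuiver V) (ε : V → Fin 2) (l : V → ℝ)
    (v : V) (t : ℤ) : ℝ :=
  labelAt ε (fun L v => Q.tropicalExchange L v - L v) l t v

/-- `ρ` is a fixed point of the T-system: its values are real numbers greater than `1`, and
`ρ(v)² = ∏_{u → v} ρ(u) + ∏_{v → w} ρ(w)` for all `v`. -/
def IsFixedPoint (Q : ClusterQuiver V) (ρ : V → ℝ) : Prop :=
  (∀ v, 1 < ρ v) ∧ ∀ v, ρ v ^ 2 = Q.exchange ρ v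

/-- The inclusion `ℚ(x) ⊆ ℝ(x)`. -/
noncomputable def toReal : RatFun ℚ V →+* RatFun ℝ V :=
  IsFractionRing.map (j := MvPolynomial.map (σ := V) (algebraMap ℚ ℝ))
    (MvPolynomial.map_injective (algebraMap ℚ ℝ) (algebraMap ℚ ℝ).injective)

/-- The real number `c` as a constant of `ℝ(x)`. -/
noncomputable def const (c : ℝ) : RatFun ℝ V :=
  algebraMap (MvPolynomial V ℝ) (RatFun ℝ V) (MvPolynomial.C c)

/-! ### The two systems satisfy their defining relations -/

theorem eps_parity {W : Type*} {ε : W → Fin 2} {u v : W} (h : ε u ≠ ε v) (t : ℤ) :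
    Even (t + eps ε u) ↔ ¬ Even (t + eps ε v) := by
  have : eps ε u = 0 ∧ eps ε v = 1 ∨ eps ε u = 1 ∧ eps ε v = 0 := by
    simp only [eps]
    omega
  simp only [Int.even_iff]
  omega

/-- A rational function that is a quotient of two polynomials taking positive values at the point
with all coordinates equal to `1`. -/
def PosAtOne {W : Type*} (f : RatFun ℚ W) : Prop :=
  ∃ p q : MvPolynomial W ℚ, 0 < MvPolynomial.eval 1 p ∧ 0 < MvPolynomial.eval 1 q ∧
    f = algebraMap _ (RatFun ℚ W) p / algebraMap _ (RatFun ℚ W) q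

theorem algebraMap_ne_zero_of_pos {W : Type*} {p : MvPolynomial W ℚ}
    (h : 0 < MvPolynomial.eval 1 p) : algebraMap _ (RatFun ℚ W) p ≠ 0 := by
  intro h0
  have : p = 0 := (IsFractionRing.injective (MvPolynomial W ℚ) (RatFun ℚ W)) (by simpa using h0)
  simp [this] at h

theorem PosAtOne.ne_zero {W : Type*} {f : RatFun ℚ W} (h : PosAtOne f) : f ≠ 0 := by
  obtain ⟨p, q, hp, hq, rfl⟩ := h
  exact div_ne_zero (algebraMap_ne_zero_of_pos hp) (algebraMap_ne_zero_of_pos hq)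

theorem PosAtOne.one {W : Type*} : PosAtOne (1 : RatFun ℚ W) :=
  ⟨1, 1, by simp, by simp, by simp⟩

theorem PosAtOne.indet {W : Type*} (v : W) : PosAtOne (indet v) :=
  ⟨MvPolynomial.X v, 1, by simp, by simp, by simp [ClusterQuiver.indet]⟩

theorem PosAtOne.mul {W : Type*} {f g : RatFun ℚ W} (hf : PosAtOne f) (hg : PosAtOne g) :
    PosAtOne (f * g) := by
  obtain ⟨p, q, hp, hq, rfl⟩ := hf
  obtain ⟨p', q', hp', hq', rfl⟩ := hg
  exact ⟨p * p', q * q', by simpa using mul_pos hp hp', by simpa using mul_pos hq hq', by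
    rw [map_mul, map_mul, div_mul_div_comm]⟩

theorem PosAtOne.div {W : Type*} {f g : RatFun ℚ W} (hf : PosAtOne f) (hg : PosAtOne g) :
    PosAtOne (f / g) := by
  obtain ⟨p, q, hp, hq, rfl⟩ := hf
  obtain ⟨p', q', hp', hq', rfl⟩ := hg
  exact ⟨p * q', q * p', by simpa using mul_pos hp hq', by simpa using mul_pos hq hp', by
    rw [map_mul, map_mul, div_div_div_eq]⟩

theorem PosAtOne.add {W : Type*} {f g : RatFun ℚ W} (hf : PosAtOne f) (hg : PosAtOne g) :
    PosAtOne (f + g) := by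
  obtain ⟨p, q, hp, hq, rfl⟩ := hf
  obtain ⟨p', q', hp', hq', rfl⟩ := hg
  refine ⟨p * q' + q * p', q * q', ?_, by simpa using mul_pos hq hq', ?_⟩
  · simpa using add_pos (mul_pos hp hq') (mul_pos hq hp')
  · rw [div_add_div _ _ (algebraMap_ne_zero_of_pos hq) (algebraMap_ne_zero_of_pos hq')]
    simp

theorem PosAtOne.prod_pow {L : V → RatFun ℚ V} (h : ∀ v, PosAtOne (L v)) (n : V → ℕ) :
    PosAtOne (∏ v, L v ^ n v) := by
  refine Finset.prod_induction _ PosAtOne (fun _ _ => PosAtOne.mul) PosAtOne.one fun v _ => ?_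
  induction n v with
  | zero => simpa using PosAtOne.one
  | succ k ih => rw [pow_succ]; exact ih.mul (h v)

theorem posAtOne_label (Q : ClusterQuiver V) (ε : V → Fin 2) (t : ℤ) (v : V) :
    PosAtOne (labelAt ε (fun L v => Q.exchange L v / L v) indet t v) := by
  have up : ∀ L : V → RatFun ℚ V, (∀ v, PosAtOne (L v)) → ∀ v, PosAtOne (Q.exchange L v / L v) :=
    fun L h v => ((PosAtOne.prod_pow h _).add (PosAtOne.prod_pow h _)).div (h v)
  have fwd : ∀ (n : ℕ) (v : V),
      PosAtOne (forwardLabel ε (fun L v => Q.exchange L v / L v) indet n v) := by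
    intro n
    induction n with
    | zero => exact PosAtOne.indet
    | succ n ih =>
      intro v
      simp only [forwardLabel]
      split_ifs
      · exact up _ ih v
      · exact ih v
  have bwd : ∀ (n : ℕ) (v : V),
      PosAtOne (backwardLabel ε (fun L v => Q.exchange L v / L v) indet n v) := by
    intro n
    induction n with
    | zero => exact PosAtOne.indet
    | succ n ih =>
      intro v
      simp only [backwardLabel]
      split_ifs
      · exact up _ ih v
      · exact ih v
  rcases t with n | n
  · exact fwd n v
  · exact bwd (n + 1) v

theorem tSystem_init (Q : ClusterQuiver V) (ε : V → Fin 2) (v : V) :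
    Q.tSystem ε v (eps ε v) = indet v :=
  labelAt_init _ _ _ _

theorem tropicalTSystem_init (Q : ClusterQuiver V) (ε : V → Fin 2) (l : V → ℝ) (v : V) :
    Q.tropicalTSystem ε l v (eps ε v) = l v :=
  labelAt_init _ _ _ _

/-- The T-system relation `T_v(t+1) T_v(t-1) = ∏_{u → v} T_u(t) + ∏_{v → w} T_w(t)`. -/
theorem tSystem_relation {Q : ClusterQuiver V} {ε : V → Fin 2} (h : Q.IsBipartition ε)
    (v : V) (t : ℤ) (ht : Even (t + 1 + eps ε v)) :
    Q.tSystem ε v (t + 1) * Q.tSystem ε v (t - 1) = Q.exchange (fun u => Q.tSystem ε u t) v := by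
  obtain ⟨s, rfl⟩ : ∃ s, t = s + 1 := ⟨t - 1, by ring⟩
  have ev : Even (s + eps ε v) := by
    simp only [Int.even_iff] at ht ⊢
    omega
  have od : ¬ Even (s + 1 + eps ε v) := by
    simp only [Int.even_iff] at ht ⊢
    omega
  obtain ⟨h1, h2⟩ := labelAt_step ε (fun L v => Q.exchange L v / L v) (indet (V := V)) s
  have h3 := (labelAt_step ε (fun L v => Q.exchange L v / L v) (indet (V := V)) (s + 1)).1 v od
  have hp := fun r => (posAtOne_label Q ε r v).ne_zero
  have nb1 : ∀ u, Q.arrows u v ≠ 0 → ¬ Even (s + eps ε u) := fun u hu he =>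
    (eps_parity (h u v hu) s).1 he ev
  have nb2 : ∀ u, Q.arrows v u ≠ 0 → ¬ Even (s + eps ε u) := fun u hu he =>
    (eps_parity (h v u hu) s).1 ev he
  simp only [tSystem]
  rw [h3, add_sub_cancel_right]
  rcases h2 with h2 | h2
  · rw [h2 v ev, div_mul_cancel₀ _ (hp s)]
    exact exchange_congr (fun u hu => (h1 u (nb1 u hu)).symm) (fun u hu => (h1 u (nb2 u hu)).symm)
  · rw [h2 v ev, mul_div_cancel₀ _ (hp (s + 1))]

/-- The tropical T-system relation
`t_v(t+1) + t_v(t-1) = max (∑_{u → v} t_u(t)) (∑_{v → w} t_w(t))`. -/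
theorem tropicalTSystem_relation {Q : ClusterQuiver V} {ε : V → Fin 2} (h : Q.IsBipartition ε)
    (l : V → ℝ) (v : V) (t : ℤ) (ht : Even (t + 1 + eps ε v)) :
    Q.tropicalTSystem ε l v (t + 1) + Q.tropicalTSystem ε l v (t - 1) =
      Q.tropicalExchange (fun u => Q.tropicalTSystem ε l u t) v := by
  obtain ⟨s, rfl⟩ : ∃ s, t = s + 1 := ⟨t - 1, by ring⟩
  have ev : Even (s + eps ε v) := by
    simp only [Int.even_iff] at ht ⊢
    omega
  have od : ¬ Even (s + 1 + eps ε v) := by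
    simp only [Int.even_iff] at ht ⊢
    omega
  obtain ⟨h1, h2⟩ := labelAt_step ε (fun L v => Q.tropicalExchange L v - L v) l s
  have h3 := (labelAt_step ε (fun L v => Q.tropicalExchange L v - L v) l (s + 1)).1 v od
  have nb1 : ∀ u, Q.arrows u v ≠ 0 → ¬ Even (s + eps ε u) := fun u hu he =>
    (eps_parity (h u v hu) s).1 he ev
  have nb2 : ∀ u, Q.arrows v u ≠ 0 → ¬ Even (s + eps ε u) := fun u hu he =>
    (eps_parity (h v u hu) s).1 ev he
  simp only [tropicalTSystem]
  rw [h3, add_sub_cancel_right]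
  rcases h2 with h2 | h2
  · rw [h2 v ev, sub_add_cancel]
    exact tropicalExchange_congr (fun u hu => (h1 u (nb1 u hu)).symm)
      (fun u hu => (h1 u (nb2 u hu)).symm)
  · rw [h2 v ev, add_sub_cancel]

end ClusterQuiver

/-! In the coordinates `L = log x` one unit of time is the combined update (`flip`) of one colour
class, an involution, and an advance by `2N` is the `N`-th power of `shift`, the product of the two
flips. The tropical system has the same structure with `max (a, b)` in place of `log (exp a + exp
b)`. These two differ by at most `log 2`, so corresponding powers of the two shifts stay at bounded
distance (`shift_zpow_mem_closePairs`).

(1) implies (3), with `c = 1`. The flip of the colour of `u` sends `δ_u` to `-δ_u`, and every flip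
conjugates the shift to its inverse. Hence the tropical power fixes `-δ_u` along with `δ_u`, and by
homogeneity the whole line through them. Bounded distance then says that `log T_v` is `r δ_u(v) +
O(1)` when only `r = log x_u` varies. By the Laurent phenomenon `T_v` is a Laurent polynomial in
`x_u`, and such growth at both ends leaves only a single monomial. So the logarithmic power is a
translation by a constant vector `κ`. Conjugation by the flip of the colour opposite to that of `v`
gives `κ(v) = -κ(v)`, so `κ = 0` (`shift_zpow_eq_one`).

(3) implies (2): the logarithmic power is a translation, so the tropical power is at bounded
distance from the identity; being homogeneous, it is the identity. A fixed point `ρ` gives a vector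
`log ρ` fixed by both flips, which forces `log c = 0`.

Most of the work is the Laurent phenomenon (`alternate_laurent`). Recurrence makes the red and blue
adjacency matrices commute. After adjoining a coefficient at each vertex, a value at a late time is
computed both from the state after one step and from the state after three steps; the two resulting
denominators are coprime, so it is Laurent in the initial state. -/

/-- A bipartite bigraph with commuting adjacency matrices: two edge multiplicities `red` and `blue`
on the vertex set `V`, without common edges, for the same bipartition. -/
structure BipartiteBigraph {V : Type*} [Fintype V] (ε : V → Fin 2) where
  red : V → V → ℕ
  blue : V → V → ℕ
  red_symm : ∀ u v, red u v = red v u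
  blue_symm : ∀ u v, blue u v = blue v u
  red_color : ∀ u v, red u v ≠ 0 → ε u ≠ ε v
  blue_color : ∀ u v, blue u v ≠ 0 → ε u ≠ ε v
  disjoint : ∀ u v, red u v = 0 ∨ blue u v = 0
  comm : ∀ u w, ∑ v, red u v * blue v w = ∑ v, blue u v * red v w

namespace ClusterQuiver

/-! ### Recurrent quivers and commuting adjacency matrices -/

section Recurrence

variable {V : Type*} {Q : ClusterQuiver V} {ε : V → Fin 2}

theorem IsBipartition.arrows_eq_zero (h : Q.IsBipartition ε) {u v : V} (huv : ε u = ε v) :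
    Q.arrows u v = 0 := by
  by_contra h0
  exact h u v h0 huv

variable [DecidableEq V]

/-- The signed number of arrows from `u` to `w`. -/
def signedArrows (Q : ClusterQuiver V) (u w : V) : ℤ := Q.arrows u w - Q.arrows w u

theorem signedArrows_mutate {u v w : V} (hu : u ≠ v) (hw : w ≠ v) :
    (Q.mutate v).signedArrows u w = Q.signedArrows u w +
      ((Q.arrows u v * Q.arrows v w : ℤ) - Q.arrows w v * Q.arrows v u) := by
  simp only [signedArrows, mutate, hu, hw, or_self, if_false]
  have key : ∀ a b : ℕ, ((a - b : ℕ) : ℤ) - ((b - a : ℕ) : ℤ) = a - b := by omega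
  rw [key]
  push_cast
  ring

theorem mutate_arrows_of_left {u v w : V} (hu : u ≠ v) (hw : w ≠ v)
    (h : Q.arrows v w = 0) (h' : Q.arrows w v = 0) :
    (Q.mutate v).arrows u w = Q.arrows u w ∧ (Q.mutate v).arrows w u = Q.arrows w u := by
  have := Q.no_two_cycle u w
  simp only [mutate, hu, hw, or_self, if_false, h, h', mul_zero, zero_mul]
  omega

/-- Vertices of colour `i` are pairwise non-adjacent, so mutating at one of them leaves the arrows
joining the others to `u` and `w` unchanged, and the contributions add up. Signed counts do not
notice the cancellation of 2-cycles. -/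
theorem signedArrows_foldl_mutate {i : Fin 2} (l : List V) (hl : l.Nodup) (hi : ∀ v ∈ l, ε v = i)
    (Q : ClusterQuiver V) (hQ : ∀ v w, ε v = i → ε w = i → Q.arrows v w = 0) {u w : V}
    (hu : ε u ≠ i) (hw : ε w ≠ i) :
    (l.foldl mutate Q).signedArrows u w = Q.signedArrows u w +
      (l.map fun v => (Q.arrows u v * Q.arrows v w : ℤ) - Q.arrows w v * Q.arrows v u).sum := by
  induction l generalizing Q with
  | nil => simp
  | cons v l ih =>
    have hv : ε v = i := hi v (by simp)
    have huv : u ≠ v := fun h => hu (h ▸ hv)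
    have hwv : w ≠ v := fun h => hw (h ▸ hv)
    have hl' := List.nodup_cons.1 hl
    rw [List.foldl_cons, ih hl'.2 (fun x hx => hi x (List.mem_cons_of_mem _ hx)) (Q.mutate v),
      signedArrows_mutate huv hwv, List.map_cons, List.sum_cons, add_assoc]
    · congr 2
      refine congrArg List.sum (List.map_congr_left fun x hx => ?_)
      have hx' : ε x = i := hi x (List.mem_cons_of_mem _ hx)
      have hxv : x ≠ v := fun h => hl'.1 (h ▸ hx)
      obtain ⟨h1, h2⟩ := mutate_arrows_of_left huv hxv (hQ v x hv hx') (hQ x v hx' hv)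
      obtain ⟨h3, h4⟩ := mutate_arrows_of_left hwv hxv (hQ v x hv hx') (hQ x v hx' hv)
      rw [h1, h2, h3, h4]
    · intro x y hx hy
      simp [mutate, hQ y x hy hx, hQ x y hx hy, hQ x v hx hv]

/-- Vertices of equal colour are joined by no arrow in `Q` or in its reverse, so the arrows that the
mutations create between them must cancel. This is the commutation relation of the bigraph. -/
theorem sum_arrows_mul_arrows [Fintype V] (hε : Q.IsBipartition ε) {i : Fin 2}
    (hQ : Q.mutateSet (Finset.univ.filter fun v => ε v = i) = Q.reverse) {u w : V}
    (hu : ε u ≠ i) (hw : ε w ≠ i) :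
    ∑ v, Q.arrows u v * Q.arrows v w = ∑ v, Q.arrows w v * Q.arrows v u := by
  have huw : ε u = ε w := by omega
  have key := signedArrows_foldl_mutate (Finset.univ.filter fun v => ε v = i).toList
    (Finset.nodup_toList _) (i := i) (ε := ε) (by simp) Q
    (fun v w hv hw => hε.arrows_eq_zero (hv.trans hw.symm)) hu hw
  rw [mutateSet] at hQ
  rw [hQ] at key
  have h0 : ∀ v, ¬ ε v = i → Q.arrows u v = 0 ∧ Q.arrows w v = 0 := fun v hv =>
    ⟨hε.arrows_eq_zero (by omega), hε.arrows_eq_zero (by omega)⟩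
  simp only [signedArrows, reverse, hε.arrows_eq_zero huw, hε.arrows_eq_zero huw.symm,
    Finset.sum_map_toList, Finset.sum_filter] at key
  zify
  rw [← sub_eq_zero, ← Finset.sum_sub_distrib]
  refine Eq.trans (Finset.sum_congr rfl fun v _ => ?_) (by simpa using key.symm)
  split_ifs with hv
  · rfl
  · simp [h0 v hv]

/-- The bipartite bigraph of a bipartite recurrent quiver: the red edges are the arrows from black
to white vertices, the blue edges are the arrows from white to black vertices. -/
def bigraph [Fintype V] (Q : ClusterQuiver V) (ε : V → Fin 2) (hε : Q.IsBipartition ε)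
    (hQ : Q.IsRecurrent ε) : BipartiteBigraph ε where
  red u v := if ε u = 0 then Q.arrows v u else Q.arrows u v
  blue u v := if ε u = 0 then Q.arrows u v else Q.arrows v u
  red_symm u v := by
    by_cases h : ε u = ε v
    · simp [hε.arrows_eq_zero h, hε.arrows_eq_zero h.symm]
    · split_ifs <;> first | rfl | omega
  blue_symm u v := by
    by_cases h : ε u = ε v
    · simp [hε.arrows_eq_zero h, hε.arrows_eq_zero h.symm]
    · split_ifs <;> first | rfl | omega
  red_color u v h := by
    split_ifs at h
    · exact (hε _ _ h).symm
    · exact hε _ _ h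
  blue_color u v h := by
    split_ifs at h
    · exact hε _ _ h
    · exact (hε _ _ h).symm
  disjoint u v := by
    split_ifs
    · exact Q.no_two_cycle _ _
    · exact Q.no_two_cycle _ _
  comm u w := by
    by_cases huw : ε u = ε w
    · by_cases hu : ε u = 0
      · have := sum_arrows_mul_arrows hε hQ.1 (u := u) (w := w) (by omega) (by omega)
        have h1 : ∀ v, Q.arrows v u * (if ε v = 0 then Q.arrows v w else Q.arrows w v) =
            Q.arrows w v * Q.arrows v u := fun v => by
          split_ifs with hv
          · simp [hε.arrows_eq_zero (hv.trans hu.symm)]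
          · ring
        have h2 : ∀ v, Q.arrows u v * (if ε v = 0 then Q.arrows w v else Q.arrows v w) =
            Q.arrows u v * Q.arrows v w := fun v => by
          split_ifs with hv
          · simp [hε.arrows_eq_zero (hu.trans hv.symm)]
          · rfl
        simp only [hu, if_true, h1, h2, this]
      · have := sum_arrows_mul_arrows hε hQ.2 (u := u) (w := w) (by omega) (by omega)
        have h1 : ∀ v, Q.arrows u v * (if ε v = 0 then Q.arrows v w else Q.arrows w v) =
            Q.arrows u v * Q.arrows v w := fun v => by
          split_ifs with hv
          · rfl
          · simp [hε.arrows_eq_zero (show ε u = ε v by omega)]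
        have h2 : ∀ v, Q.arrows v u * (if ε v = 0 then Q.arrows w v else Q.arrows v w) =
            Q.arrows w v * Q.arrows v u := fun v => by
          split_ifs with hv
          · ring
          · simp [hε.arrows_eq_zero (show ε v = ε u by omega)]
        simp only [hu, if_false, h1, h2, this]
    -- If `u` and `w` have different colours, every `v` shares its colour with one of them, so all
    -- terms vanish.
    · refine (Finset.sum_eq_zero fun v _ => ?_).trans (Finset.sum_eq_zero fun v _ => ?_).symm
      · by_cases h : ε u = ε v
        · simp [hε.arrows_eq_zero h, hε.arrows_eq_zero h.symm]
        · simp [hε.arrows_eq_zero (show ε v = ε w by omega),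
            hε.arrows_eq_zero (show ε w = ε v by omega)]
      · by_cases h : ε u = ε v
        · simp [hε.arrows_eq_zero h, hε.arrows_eq_zero h.symm]
        · simp [hε.arrows_eq_zero (show ε v = ε w by omega),
            hε.arrows_eq_zero (show ε w = ε v by omega)]

end Recurrence

end ClusterQuiver

/-! ### Laurent polynomials as functions on the real torus -/

section LaurentFunctions

variable {ι : Type*}

/-- The ring of Laurent polynomial functions on the real torus. -/
def laurentFn (ι : Type*) : Subalgebra ℝ ((ι → ℝˣ) → ℝ) :=
  Algebra.adjoin ℝ ((Set.range fun (i : ι) (z : ι → ℝˣ) => (z i : ℝ)) ∪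
    Set.range fun (i : ι) (z : ι → ℝˣ) => (z i : ℝ)⁻¹)

theorem coord_mem_laurentFn (i : ι) : (fun z : ι → ℝˣ => (z i : ℝ)) ∈ laurentFn ι :=
  Algebra.subset_adjoin (Or.inl ⟨i, rfl⟩)

theorem coord_inv_mem_laurentFn (i : ι) : (fun z : ι → ℝˣ => (z i : ℝ)⁻¹) ∈ laurentFn ι :=
  Algebra.subset_adjoin (Or.inr ⟨i, rfl⟩)

@[elab_as_elim]
theorem laurentFn_induction {p : ((ι → ℝˣ) → ℝ) → Prop}
    (coord : ∀ i, p fun z => (z i : ℝ)) (coord_inv : ∀ i, p fun z => (z i : ℝ)⁻¹)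
    (const : ∀ r : ℝ, p fun _ => r)
    (add : ∀ f g, f ∈ laurentFn ι → g ∈ laurentFn ι → p f → p g → p (f + g))
    (mul : ∀ f g, f ∈ laurentFn ι → g ∈ laurentFn ι → p f → p g → p (f * g))
    {f : (ι → ℝˣ) → ℝ} (hf : f ∈ laurentFn ι) : p f := by
  refine Algebra.adjoin_induction (p := fun f _ => p f) ?_ const add mul hf
  rintro _ (⟨i, rfl⟩ | ⟨i, rfl⟩)
  · exact coord i
  · exact coord_inv i

theorem prod_pow_mem_laurentFn {κ : Type*} [Fintype κ] {f : κ → (ι → ℝˣ) → ℝ}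
    (hf : ∀ k, f k ∈ laurentFn ι) (n : κ → ℕ) :
    (fun z => ∏ k, f k z ^ n k) ∈ laurentFn ι := by
  have : (fun z => ∏ k, f k z ^ n k) = ∏ k, f k ^ n k := by
    ext z
    simp [Finset.prod_apply]
  rw [this]
  exact prod_mem fun k _ => pow_mem (hf k) _

theorem continuous_of_mem_laurentFn {f : (ι → ℝˣ) → ℝ} (hf : f ∈ laurentFn ι) :
    Continuous f := by
  refine laurentFn_induction (fun i => ?_) (fun i => ?_) (fun r => continuous_const)
    (fun f g _ _ hf hg => hf.add hg) (fun f g _ _ hf hg => hf.mul hg) hf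
  · exact Units.continuous_val.comp (continuous_apply i)
  · exact (Units.continuous_val.comp (continuous_apply i)).inv₀ fun z => (z i).ne_zero

theorem exists_polynomial_of_mem_laurentFn [Fintype ι] {f : (ι → ℝˣ) → ℝ}
    (hf : f ∈ laurentFn ι) : ∃ (P : MvPolynomial ι ℝ) (n : ℕ), ∀ z : ι → ℝˣ,
      f z * (∏ i, (z i : ℝ)) ^ n = MvPolynomial.eval (fun i => (z i : ℝ)) P := by
  classical
  refine laurentFn_induction (fun i => ?_) (fun i => ?_) (fun r => ?_) ?_ ?_ hf
  · exact ⟨MvPolynomial.X i, 0, by simp⟩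
  · refine ⟨∏ j ∈ Finset.univ.erase i, MvPolynomial.X j, 1, fun z => ?_⟩
    rw [pow_one, ← Finset.mul_prod_erase Finset.univ _ (Finset.mem_univ i), map_prod]
    simp
  · exact ⟨MvPolynomial.C r, 0, by simp⟩
  · rintro f g - - ⟨P, n, hP⟩ ⟨P', n', hP'⟩
    refine ⟨P * (∏ j, MvPolynomial.X j) ^ n' + P' * (∏ j, MvPolynomial.X j) ^ n, n + n',
      fun z => ?_⟩
    simp only [Pi.add_apply, map_add, map_mul, ← hP, ← hP', map_pow, map_prod,
      MvPolynomial.eval_X]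
    ring
  · rintro f g - - ⟨P, n, hP⟩ ⟨P', n', hP'⟩
    refine ⟨P * P', n + n', fun z => ?_⟩
    simp only [Pi.mul_apply, map_mul, ← hP, ← hP']
    ring

theorem prod_units_ne_zero [Fintype ι] (z : ι → ℝˣ) (n : ℕ) : (∏ i, (z i : ℝ)) ^ n ≠ 0 :=
  pow_ne_zero _ (Finset.prod_ne_zero_iff.2 fun i _ => (z i).ne_zero)

theorem eq_zero_of_mul_prod_units_pow [Fintype ι] {z : ι → ℝˣ} {n : ℕ} {r : ℝ}
    (h : r * (∏ i, (z i : ℝ)) ^ n = 0) : r = 0 :=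
  (mul_eq_zero.1 h).resolve_right (prod_units_ne_zero z n)

theorem MvPolynomial.eq_of_eval_pos [Finite ι] {P P' : MvPolynomial ι ℝ}
    (h : ∀ x : ι → ℝ, (∀ i, 0 < x i) → MvPolynomial.eval x P = MvPolynomial.eval x P') :
    P = P' :=
  MvPolynomial.funext_set (fun _ => Set.Ioi 0) (fun _ => Set.Ioi_infinite 0) fun x hx =>
    h x fun i => hx i (Set.mem_univ i)

/-- The positive orthant is Zariski dense. The dynamics is compared with Laurent functions at
positive points only, whereas divisibility is tested on the zero set of some `first u`, which
contains no positive point; this lemma links the two. -/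
theorem eq_of_eq_on_pos [Fintype ι] {f g : (ι → ℝˣ) → ℝ} (hf : f ∈ laurentFn ι)
    (hg : g ∈ laurentFn ι) (h : ∀ z : ι → ℝˣ, (∀ i, 0 < (z i : ℝ)) → f z = g z) : f = g := by
  obtain ⟨P, n, hP⟩ := exists_polynomial_of_mem_laurentFn (sub_mem hf hg)
  have hP0 : P = 0 := MvPolynomial.eq_of_eval_pos fun x hx => by
    have := hP fun i => Units.mk0 (x i) (hx i).ne'
    simpa [h (fun i => Units.mk0 (x i) (hx i).ne') hx] using this.symm
  ext z
  exact sub_eq_zero.1 (eq_zero_of_mul_prod_units_pow ((hP z).trans (by simp [hP0])))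

/-- Laurent functions form a domain. This makes "not vanishing identically on the zero set of `first
u`" a multiplicative condition, so that it can serve as coprimality to `first u`. -/
theorem eq_zero_or_eq_zero_of_mem_laurentFn [Fintype ι] {f g : (ι → ℝˣ) → ℝ}
    (hf : f ∈ laurentFn ι) (hg : g ∈ laurentFn ι) (h : f * g = 0) : f = 0 ∨ g = 0 := by
  obtain ⟨P, n, hP⟩ := exists_polynomial_of_mem_laurentFn hf
  obtain ⟨P', n', hP'⟩ := exists_polynomial_of_mem_laurentFn hg
  have hPP : P * P' = 0 := MvPolynomial.eq_of_eval_pos fun x hx => by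
    have h1 := hP fun i => Units.mk0 (x i) (hx i).ne'
    have h2 := hP' fun i => Units.mk0 (x i) (hx i).ne'
    have h3 := congrFun h fun i => Units.mk0 (x i) (hx i).ne'
    simp only [Units.val_mk0, Pi.mul_apply, Pi.zero_apply] at h1 h2 h3
    rw [map_mul, ← h1, ← h2, mul_mul_mul_comm, h3, zero_mul, map_zero]
  rcases mul_eq_zero.1 hPP with h0 | h0
  · left
    ext z
    exact eq_zero_of_mul_prod_units_pow ((hP z).trans (by simp [h0]))
  · right
    ext z
    exact eq_zero_of_mul_prod_units_pow ((hP' z).trans (by simp [h0]))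

/-- The Laurent functions without zeros whose inverses are Laurent functions. -/
def laurentUnit (ι : Type*) : Subgroup ((ι → ℝˣ) → ℝˣ) where
  carrier := {u | (fun z => (u z : ℝ)) ∈ laurentFn ι ∧ (fun z => (u z : ℝ)⁻¹) ∈ laurentFn ι}
  one_mem' := by
    constructor
    · exact one_mem (laurentFn ι)
    · convert one_mem (laurentFn ι) using 1
      ext z
      simp
  mul_mem' {u w} hu hw := by
    refine ⟨mul_mem hu.1 hw.1, ?_⟩
    have := mul_mem hu.2 hw.2
    convert this using 1
    ext z
    simp [mul_comm]
  inv_mem' {u} hu := by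
    refine ⟨by simpa using hu.2, by simpa using hu.1⟩

theorem coord_mem_laurentUnit (i : ι) : (fun z : ι → ℝˣ => z i) ∈ laurentUnit ι :=
  ⟨coord_mem_laurentFn i, coord_inv_mem_laurentFn i⟩

theorem neg_mem_laurentUnit {u : (ι → ℝˣ) → ℝˣ} (hu : u ∈ laurentUnit ι) :
    -u ∈ laurentUnit ι := by
  refine ⟨?_, ?_⟩
  · exact neg_mem hu.1
  · have := neg_mem hu.2
    convert this using 1
    ext z
    simp [inv_neg]

theorem prod_pow_mem_laurentUnit {κ : Type*} [Fintype κ] {f : κ → (ι → ℝˣ) → ℝˣ}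
    (hf : ∀ k, f k ∈ laurentUnit ι) (n : κ → ℕ) :
    (fun z => ∏ k, f k z ^ n k) ∈ laurentUnit ι := by
  have : (fun z => ∏ k, f k z ^ n k) = ∏ k, f k ^ n k := by
    ext z
    simp [Finset.prod_apply]
  rw [this]
  exact prod_mem fun k _ => pow_mem (hf k) _

theorem comp_mem_laurentFn {f : (ι → ℝˣ) → ℝ} (hf : f ∈ laurentFn ι) {g : (ι → ℝˣ) → ι → ℝˣ}
    (hg : ∀ i, (fun z => g z i) ∈ laurentUnit ι) : (fun z => f (g z)) ∈ laurentFn ι := by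
  refine laurentFn_induction (p := fun f => (fun z => f (g z)) ∈ laurentFn ι)
    (fun i => (hg i).1) (fun i => (hg i).2) (fun r => ?_)
    (fun f g _ _ hf hg => add_mem hf hg) (fun f g _ _ hf hg => mul_mem hf hg) hf
  exact (laurentFn ι).algebraMap_mem r

/-- On the positive orthant, `h` is a quotient of a Laurent function by an element of `M`. -/
def IsLaurentFrac (M : Submonoid ((ι → ℝˣ) → ℝ)) (h : (ι → ℝˣ) → ℝ) : Prop :=
  ∃ A ∈ laurentFn ι, ∃ m ∈ M, ∀ z : ι → ℝˣ, (∀ i, 0 < (z i : ℝ)) → h z * m z = A z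

theorem IsLaurentFrac.of_mem {M : Submonoid ((ι → ℝˣ) → ℝ)} {h A : (ι → ℝˣ) → ℝ}
    (hA : A ∈ laurentFn ι) (hh : ∀ z : ι → ℝˣ, (∀ i, 0 < (z i : ℝ)) → h z = A z) :
    IsLaurentFrac M h :=
  ⟨A, hA, 1, one_mem M, fun z hz => by simp [hh z hz]⟩

theorem IsLaurentFrac.add {M : Submonoid ((ι → ℝˣ) → ℝ)} {h h' : (ι → ℝˣ) → ℝ}
    (hM : ∀ m ∈ M, m ∈ laurentFn ι) (H : IsLaurentFrac M h) (H' : IsLaurentFrac M h') :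
    IsLaurentFrac M (h + h') := by
  obtain ⟨A, hA, m, hm, e⟩ := H
  obtain ⟨A', hA', m', hm', e'⟩ := H'
  refine ⟨A * m' + A' * m, add_mem (mul_mem hA (hM _ hm')) (mul_mem hA' (hM _ hm)), m * m',
    mul_mem hm hm', fun z hz => ?_⟩
  simp only [Pi.add_apply, Pi.mul_apply, ← e z hz, ← e' z hz]
  ring

theorem IsLaurentFrac.mul {M : Submonoid ((ι → ℝˣ) → ℝ)} {h h' : (ι → ℝˣ) → ℝ}
    (H : IsLaurentFrac M h) (H' : IsLaurentFrac M h') : IsLaurentFrac M (h * h') := by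
  obtain ⟨A, hA, m, hm, e⟩ := H
  obtain ⟨A', hA', m', hm', e'⟩ := H'
  refine ⟨A * A', mul_mem hA hA', m * m', mul_mem hm hm', fun z hz => ?_⟩
  simp only [Pi.mul_apply, ← e z hz, ← e' z hz]
  ring

/-- The point `z'` is quantified separately because the substituted values are real numbers, which
form a point of the torus only where they are nonzero. -/
theorem IsLaurentFrac.comp {M : Submonoid ((ι → ℝˣ) → ℝ)} (hM : ∀ m ∈ M, m ∈ laurentFn ι)
    {f : (ι → ℝˣ) → ℝ} (hf : f ∈ laurentFn ι) {g : ι → (ι → ℝˣ) → ℝ}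
    (hg : ∀ i, IsLaurentFrac M (g i)) (hg' : ∀ i, IsLaurentFrac M fun z => (g i z)⁻¹) :
    ∃ h, IsLaurentFrac M h ∧ ∀ z : ι → ℝˣ, (∀ i, 0 < (z i : ℝ)) →
      ∀ z' : ι → ℝˣ, (∀ i, (z' i : ℝ) = g i z) → h z = f z' := by
  refine laurentFn_induction (fun i => ?_) (fun i => ?_) (fun r => ?_) ?_ ?_ hf
  · exact ⟨g i, hg i, fun z _ z' h => (h i).symm⟩
  · exact ⟨_, hg' i, fun z _ z' h => by simp [h i]⟩
  · exact ⟨fun _ => r, .of_mem ((laurentFn ι).algebraMap_mem r) fun _ _ => rfl, fun _ _ _ _ => rfl⟩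
  · rintro f f' - - ⟨h, H, e⟩ ⟨h', H', e'⟩
    exact ⟨h + h', H.add hM H', fun z hz z' hz' => by simp [e z hz z' hz', e' z hz z' hz']⟩
  · rintro f f' - - ⟨h, H, e⟩ ⟨h', H', e'⟩
    exact ⟨h * h', H.mul H', fun z hz z' hz' => by simp [e z hz z' hz', e' z hz z' hz']⟩

/-- The restriction of a Laurent function to a line parallel to a coordinate axis is a Laurent
polynomial in one variable. -/
theorem exists_polynomial_update [DecidableEq ι] {f : (ι → ℝˣ) → ℝ} (hf : f ∈ laurentFn ι)
    (z : ι → ℝˣ) (i : ι) : ∃ (P : Polynomial ℝ) (n : ℕ), ∀ s : ℝˣ,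
      f (Function.update z i s) * (s : ℝ) ^ n = P.eval (s : ℝ) := by
  refine laurentFn_induction (fun j => ?_) (fun j => ?_) (fun r => ?_) ?_ ?_ hf
  · rcases eq_or_ne j i with rfl | hj
    · exact ⟨Polynomial.X, 0, by simp⟩
    · exact ⟨Polynomial.C (z j : ℝ), 0, by simp [hj]⟩
  · rcases eq_or_ne j i with rfl | hj
    · exact ⟨1, 1, by simp⟩
    · exact ⟨Polynomial.C (z j : ℝ)⁻¹, 0, by simp [hj]⟩
  · exact ⟨Polynomial.C r, 0, by simp⟩
  · rintro f g - - ⟨P, n, hP⟩ ⟨P', n', hP'⟩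
    refine ⟨P * Polynomial.X ^ n' + P' * Polynomial.X ^ n, n + n', fun s => ?_⟩
    simp only [Pi.add_apply, Polynomial.eval_add, Polynomial.eval_mul, ← hP, ← hP',
      Polynomial.eval_pow, Polynomial.eval_X]
    ring
  · rintro f g - - ⟨P, n, hP⟩ ⟨P', n', hP'⟩
    refine ⟨P * P', n + n', fun s => ?_⟩
    simp only [Pi.mul_apply, Polynomial.eval_mul, ← hP, ← hP']
    ring

end LaurentFunctions

/-! ### The T-system with coefficients on a bigraph -/

namespace BipartiteBigraph

open Sum

variable {V : Type*} [Fintype V] {ε : V → Fin 2} (B : BipartiteBigraph ε)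

/-- The right-hand side of the exchange relation at `v` with coefficient `y`. -/
def twoTerm (v : V) (y : ℝ) (x : V → ℝ) : ℝ :=
  y * ∏ w, x w ^ B.red v w + ∏ w, x w ^ B.blue v w

variable {B} in
theorem twoTerm_congr {v : V} {x x' : V → ℝ} (h : ∀ w, ε w ≠ ε v → x w = x' w) (y : ℝ) :
    B.twoTerm v y x = B.twoTerm v y x' := by
  unfold twoTerm
  refine congrArg₂ _ (congrArg _ (Finset.prod_congr rfl fun w _ => ?_))
    (Finset.prod_congr rfl fun w _ => ?_)
  · by_cases hw : B.red v w = 0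
    · simp [hw]
    · rw [h w (B.red_color v w hw).symm]
  · by_cases hw : B.blue v w = 0
    · simp [hw]
    · rw [h w (B.blue_color v w hw).symm]

theorem twoTerm_pos {v : V} {y : ℝ} {x : V → ℝ} (hy : 0 < y) (hx : ∀ w, 0 < x w) :
    0 < B.twoTerm v y x :=
  add_pos (mul_pos hy (Finset.prod_pos fun w _ => pow_pos (hx w) _))
    (Finset.prod_pos fun w _ => pow_pos (hx w) _)

theorem twoTerm_mem {ι : Type*} (v : V) {y : (ι → ℝˣ) → ℝ} (hy : y ∈ laurentFn ι)
    {x : V → (ι → ℝˣ) → ℝ} (hx : ∀ w, x w ∈ laurentFn ι) :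
    (fun z => B.twoTerm v (y z) fun w => x w z) ∈ laurentFn ι :=
  add_mem (mul_mem hy (prod_pow_mem_laurentFn hx _)) (prod_pow_mem_laurentFn hx _)

/-- One step of the T-system with coefficients: the vertices of colour `i` are updated.  The
component `inl v` of a state is the value at `v`, the component `inr v` is the coefficient. -/
noncomputable def step (i : Fin 2) (z : V ⊕ V → ℝ) : V ⊕ V → ℝ :=
  Sum.elim
    (fun v => if ε v = i then B.twoTerm v (z (inr v)) (fun w => z (inl w)) / z (inl v)
      else z (inl v))
    (fun v => if ε v = i then (∏ w, z (inr w) ^ B.blue v w) / z (inr v) else z (inr v))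

/-- Alternating steps, beginning with the colour `i`. -/
noncomputable def alternate : ℕ → Fin 2 → (V ⊕ V → ℝ) → V ⊕ V → ℝ
  | 0, _, z => z
  | n + 1, i, z => alternate n (i + 1) (B.step i z)

theorem step_pos {i : Fin 2} {z : V ⊕ V → ℝ} (hz : ∀ k, 0 < z k) (k : V ⊕ V) :
    0 < B.step i z k := by
  rcases k with v | v
  · simp only [step, elim_inl]
    split_ifs
    · exact div_pos (B.twoTerm_pos (hz _) fun _ => hz _) (hz _)
    · exact hz _
  · simp only [step, elim_inr]
    split_ifs
    · exact div_pos (Finset.prod_pos fun w _ => pow_pos (hz _) _) (hz _)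
    · exact hz _

/-- The value at `v` after one update. -/
noncomputable def first (v : V) (z : V ⊕ V → ℝˣ) : ℝ :=
  B.twoTerm v (z (inr v)) (fun w => z (inl w)) * (z (inl v) : ℝ)⁻¹

/-- The value at `v` after an update of its neighbours and then an update of `v`. -/
noncomputable def second (v : V) (z : V ⊕ V → ℝˣ) : ℝ :=
  B.twoTerm v (z (inr v)) (fun w => B.first w z) * (z (inl v) : ℝ)⁻¹

/-- The coefficient at `v` after one update. -/
noncomputable def newCoeff (v : V) (z : V ⊕ V → ℝˣ) : ℝˣ :=
  (∏ w, z (inr w) ^ B.blue v w) / z (inr v)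

/-- The numerator of the value at `v` after two updates of `v`. -/
noncomputable def thirdNum (v : V) (z : V ⊕ V → ℝˣ) : ℝ :=
  B.twoTerm v (B.newCoeff v z) (fun w => B.second w z)

theorem first_mem (v : V) : B.first v ∈ laurentFn (V ⊕ V) :=
  mul_mem (B.twoTerm_mem v (coord_mem_laurentFn _) fun _ => coord_mem_laurentFn _)
    (coord_inv_mem_laurentFn _)

theorem second_mem (v : V) : B.second v ∈ laurentFn (V ⊕ V) :=
  mul_mem (B.twoTerm_mem v (coord_mem_laurentFn _) B.first_mem) (coord_inv_mem_laurentFn _)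

theorem newCoeff_mem (v : V) : B.newCoeff v ∈ laurentUnit (V ⊕ V) :=
  div_mem (prod_pow_mem_laurentUnit (fun w => coord_mem_laurentUnit (inr w)) _)
    (coord_mem_laurentUnit _)

theorem thirdNum_mem (v : V) : B.thirdNum v ∈ laurentFn (V ⊕ V) :=
  B.twoTerm_mem v (B.newCoeff_mem v).1 B.second_mem

theorem first_pos {v : V} {z : V ⊕ V → ℝˣ} (hz : ∀ k, 0 < (z k : ℝ)) : 0 < B.first v z :=
  mul_pos (B.twoTerm_pos (hz _) fun _ => hz _) (inv_pos.2 (hz _))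

/-! ### Divisibility by the value after one update -/

/-- The value of the coefficient at `u` for which `first u` vanishes. -/
noncomputable def rootCoeff (u : V) (z : V ⊕ V → ℝˣ) : ℝˣ :=
  -((∏ w, z (inl w) ^ B.blue u w) / ∏ w, z (inl w) ^ B.red u w)

theorem rootCoeff_mem (u : V) : B.rootCoeff u ∈ laurentUnit (V ⊕ V) :=
  neg_mem_laurentUnit (div_mem
    (prod_pow_mem_laurentUnit (fun w => coord_mem_laurentUnit (inl w)) _)
    (prod_pow_mem_laurentUnit (fun w => coord_mem_laurentUnit (inl w)) _))

/-- `first u` is affine in the coefficient at `u`, with slope a Laurent monomial. This is the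
purpose of the coefficients: the zero set of `first u` becomes a graph over the other coordinates,
hence the image of a retraction of the torus. -/
theorem coeff_sub_rootCoeff (u : V) (z : V ⊕ V → ℝˣ) :
    (z (inr u) : ℝ) - B.rootCoeff u z =
      B.first u z * (z (inl u) * (∏ w, (z (inl w) : ℝ) ^ B.red u w)⁻¹) := by
  have h : ∏ w, (z (inl w) : ℝ) ^ B.red u w ≠ 0 :=
    Finset.prod_ne_zero_iff.2 fun w _ => pow_ne_zero _ (z _).ne_zero
  have h' := (z (inl u)).ne_zero
  simp only [rootCoeff, first, twoTerm, Units.val_neg, Units.val_div_eq_div_val, Units.coe_prod,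
    Units.val_pow_eq_pow_val]
  field_simp
  ring

variable [DecidableEq V]

/-- The retraction of the torus to the zero set of `first u`. -/
noncomputable def retract (u : V) (z : V ⊕ V → ℝˣ) : V ⊕ V → ℝˣ :=
  Function.update z (inr u) (B.rootCoeff u z)

theorem retract_coord_mem (u : V) (k : V ⊕ V) :
    (fun z => B.retract u z k) ∈ laurentUnit (V ⊕ V) := by
  by_cases h : k = inr u
  · subst h
    simpa [retract] using B.rootCoeff_mem u
  · simpa [retract, h] using coord_mem_laurentUnit k

theorem comp_retract_mem (u : V) {f : (V ⊕ V → ℝˣ) → ℝ} (hf : f ∈ laurentFn (V ⊕ V)) :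
    (fun z => f (B.retract u z)) ∈ laurentFn (V ⊕ V) :=
  comp_mem_laurentFn hf (B.retract_coord_mem u)

theorem first_retract (u : V) (z : V ⊕ V → ℝˣ) : B.first u (B.retract u z) = 0 := by
  have h := B.coeff_sub_rootCoeff u (B.retract u z)
  have h1 : B.rootCoeff u (B.retract u z) = B.rootCoeff u z := by simp [rootCoeff, retract]
  rw [h1] at h
  simp only [retract, Function.update_self, sub_self] at h
  refine (mul_eq_zero.1 h.symm).resolve_right (mul_ne_zero (Units.ne_zero _) (inv_ne_zero ?_))
  exact Finset.prod_ne_zero_iff.2 fun w _ => pow_ne_zero _ (Units.ne_zero _)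

theorem retract_eq_self {u : V} {z : V ⊕ V → ℝˣ} (h : B.first u z = 0) :
    B.retract u z = z := by
  have := B.coeff_sub_rootCoeff u z
  rw [h, zero_mul, sub_eq_zero] at this
  rw [retract, ← Units.ext this, Function.update_eq_self]

/-- The retraction moves a single coordinate, by a multiple of `first u`; divisibility of the
difference passes to sums and products by the Leibniz rule. -/
theorem exists_sub_comp_retract (u : V) {f : (V ⊕ V → ℝˣ) → ℝ} (hf : f ∈ laurentFn (V ⊕ V)) :
    ∃ g ∈ laurentFn (V ⊕ V), ∀ z, f z - f (B.retract u z) = B.first u z * g z := by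
  have hq : (fun z : V ⊕ V → ℝˣ => (z (inl u) : ℝ) * (∏ w, (z (inl w) : ℝ) ^ B.red u w)⁻¹) ∈
      laurentFn (V ⊕ V) := by
    refine mul_mem (coord_mem_laurentFn _) ?_
    simpa using (prod_pow_mem_laurentUnit (fun w => coord_mem_laurentUnit (inl w))
      (B.red u)).2
  refine laurentFn_induction (fun k => ?_) (fun k => ?_) (fun r => ?_) ?_ ?_ hf
  · by_cases h : k = inr u
    · subst h
      refine ⟨_, hq, fun z => ?_⟩
      simpa [retract] using B.coeff_sub_rootCoeff u z
    · exact ⟨0, zero_mem _, by simp [retract, h]⟩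
  · by_cases h : k = inr u
    · subst h
      refine ⟨_, mul_mem (neg_mem hq) (mul_mem (coord_inv_mem_laurentFn (inr u))
        (B.rootCoeff_mem u).2), fun z => ?_⟩
      have h1 := (z (inr u)).ne_zero
      have h2 := (B.rootCoeff u z).ne_zero
      have := B.coeff_sub_rootCoeff u z
      simp only [retract, Function.update_self, Pi.mul_apply, Pi.neg_apply]
      rw [inv_sub_inv h1 h2, ← neg_sub, this]
      field_simp
    · exact ⟨0, zero_mem _, by simp [retract, h]⟩
  · exact ⟨0, zero_mem _, by simp⟩
  · rintro f f' - - ⟨g, hg, e⟩ ⟨g', hg', e'⟩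
    refine ⟨g + g', add_mem hg hg', fun z => ?_⟩
    simp only [Pi.add_apply]
    linear_combination e z + e' z
  · rintro f f' hf hf' ⟨g, hg, e⟩ ⟨g', hg', e'⟩
    refine ⟨_, add_mem (mul_mem hg hf') (mul_mem (B.comp_retract_mem u hf) hg'), fun z => ?_⟩
    simp only [Pi.add_apply, Pi.mul_apply]
    linear_combination f' z * e z + f (B.retract u z) * e' z

theorem exists_eq_first_mul (u : V) {f : (V ⊕ V → ℝˣ) → ℝ} (hf : f ∈ laurentFn (V ⊕ V))
    (h : ∀ z, f (B.retract u z) = 0) : ∃ g ∈ laurentFn (V ⊕ V), f = B.first u * g := by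
  obtain ⟨g, hg, e⟩ := B.exists_sub_comp_retract u hf
  refine ⟨g, hg, funext fun z => ?_⟩
  simpa [h z] using e z

-- If `first u = 0`, one of the two products in `second v` vanishes at each neighbour `v` of `u`:
-- the red one along a red edge, the blue one along a blue edge. The surviving products over red
-- neighbours and over blue neighbours contribute the same product of values `first w`, because the
-- matrices commute. With the rule for `newCoeff`, what remains is a multiple of the numerator of
-- `first u`.
omit [DecidableEq V] in
theorem thirdNum_eq_zero {u : V} {z : V ⊕ V → ℝˣ} (h : B.first u z = 0) :
    B.thirdNum u z = 0 := by
  have hr : ∀ v, B.second v z ^ B.red u v =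
      (∏ w, B.first w z ^ (B.red u v * B.blue v w)) * ((z (inl v) : ℝ) ^ B.red u v)⁻¹ := fun v => by
    by_cases hv : B.red u v = 0
    · simp [hv]
    · have h0 : ∏ w, B.first w z ^ B.red v w = 0 :=
        Finset.prod_eq_zero (Finset.mem_univ u) (by
          rw [h, zero_pow]
          rwa [B.red_symm])
      rw [second, twoTerm, h0, mul_zero, zero_add, mul_pow, inv_pow, ← Finset.prod_pow]
      simp only [← pow_mul, mul_comm]
  have hb : ∀ v, B.second v z ^ B.blue u v = (z (inr v) : ℝ) ^ B.blue u v *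
      (∏ w, B.first w z ^ (B.blue u v * B.red v w)) * ((z (inl v) : ℝ) ^ B.blue u v)⁻¹ :=
    fun v => by
    by_cases hv : B.blue u v = 0
    · simp [hv]
    · have h0 : ∏ w, B.first w z ^ B.blue v w = 0 :=
        Finset.prod_eq_zero (Finset.mem_univ u) (by
          rw [h, zero_pow]
          rwa [B.blue_symm])
      rw [second, twoTerm, h0, add_zero, mul_pow, mul_pow, inv_pow, ← Finset.prod_pow]
      simp only [← pow_mul, mul_comm (B.blue u v)]
  have hK : ∏ v, ∏ w, B.first w z ^ (B.blue u v * B.red v w) =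
      ∏ v, ∏ w, B.first w z ^ (B.red u v * B.blue v w) := by
    rw [Finset.prod_comm, Finset.prod_comm (f := fun v w => B.first w z ^ (B.red u v * B.blue v w))]
    simp only [Finset.prod_pow_eq_pow_sum, B.comm]
  have hR : ∏ w, (z (inl w) : ℝ) ^ B.red u w ≠ 0 :=
    Finset.prod_ne_zero_iff.2 fun w _ => pow_ne_zero _ (z _).ne_zero
  have hB : ∏ w, (z (inl w) : ℝ) ^ B.blue u w ≠ 0 :=
    Finset.prod_ne_zero_iff.2 fun w _ => pow_ne_zero _ (z _).ne_zero
  have hu := (z (inr u)).ne_zero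
  have h1 : B.twoTerm u (z (inr u)) (fun w => z (inl w)) = 0 :=
    (mul_eq_zero.1 h).resolve_right (inv_ne_zero (z _).ne_zero)
  rw [twoTerm] at h1
  rw [thirdNum, twoTerm]
  simp only [hr, hb, Finset.prod_mul_distrib, hK, newCoeff, Units.val_div_eq_div_val,
    Units.coe_prod, Units.val_pow_eq_pow_val, Finset.prod_inv_distrib]
  field_simp
  linear_combination ((∏ v, (z (inr v) : ℝ) ^ B.blue u v) *
    ∏ v, ∏ w, B.first w z ^ (B.red u v * B.blue v w)) * h1

theorem exists_third (u : V) : ∃ e ∈ laurentFn (V ⊕ V), B.thirdNum u = B.first u * e :=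
  B.exists_eq_first_mul u (B.thirdNum_mem u) fun z => B.thirdNum_eq_zero (B.first_retract u z)

end BipartiteBigraph

namespace BipartiteBigraph

open Sum

variable {V : Type*} [Fintype V] {ε : V → Fin 2} (B : BipartiteBigraph ε) [DecidableEq V]

/-! ### Coprimality of the values after one, two and three steps -/

/-- A single zero of `first u` at which `f` is nonzero suffices, since the retraction fixes that
point. -/
theorem nonvanishing_of_eq_zero {u : V} {f : (V ⊕ V → ℝˣ) → ℝ} {z : V ⊕ V → ℝˣ}
    (hz : B.first u z = 0) (hf : f z ≠ 0) : (fun z => f (B.retract u z)) ≠ 0 := fun h =>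
  hf (by simpa [B.retract_eq_self hz] using congrFun h z)

/-- All coordinates are `1`, except that the coefficient at `u` is `-1`. -/
def signPoint (u : V) : V ⊕ V → ℝˣ := Function.update 1 (inr u) (-1)

theorem first_signPoint_self (u : V) : B.first u (signPoint u) = 0 := by
  simp [first, twoTerm, signPoint]

theorem first_signPoint {u v : V} (h : v ≠ u) : 0 < B.first v (signPoint u) := by
  simp [first, twoTerm, signPoint, h]

/-- Only `first u` vanishes at this point, and the edge sets are disjoint, so at most one of the two
products at `v` is lost. -/
theorem second_signPoint {u v : V} (h : ε v ≠ ε u) : 0 < B.second v (signPoint u) := by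
  have hvu : v ≠ u := fun e => h (congrArg ε e)
  have nonneg : ∀ w, 0 ≤ B.first w (signPoint u) := fun w => by
    rcases eq_or_ne w u with rfl | hw
    · rw [first_signPoint_self]
    · exact (B.first_signPoint hw).le
  have pos : ∀ n : V → ℕ, n u = 0 → 0 < ∏ w, B.first w (signPoint u) ^ n w := fun n hn => by
    refine Finset.prod_pos fun w _ => ?_
    rcases eq_or_ne w u with rfl | hw
    · simp [hn]
    · exact pow_pos (B.first_signPoint hw) _
  have h0 : ∀ n : V → ℕ, 0 ≤ ∏ w, B.first w (signPoint u) ^ n w := fun n =>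
    Finset.prod_nonneg fun w _ => pow_nonneg (nonneg w) _
  have : 0 < ∏ w, B.first w (signPoint u) ^ B.red v w +
      ∏ w, B.first w (signPoint u) ^ B.blue v w := by
    rcases B.disjoint v u with h | h
    · exact add_pos_of_pos_of_nonneg (pos _ h) (h0 _)
    · exact add_pos_of_nonneg_of_pos (h0 _) (pos _ h)
  simpa [second, twoTerm, signPoint, hvu] using this

theorem thirdNum_signPoint {u v : V} (hv : v ≠ u) (h : ε v = ε u) :
    0 < B.thirdNum v (signPoint u) := by
  have h1 : (B.newCoeff v (signPoint u) : ℝ) = 1 := by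
    rw [Units.val_eq_one, newCoeff]
    have : ∀ w, (signPoint u (inr w)) ^ B.blue v w = 1 := fun w => by
      rcases eq_or_ne w u with rfl | hw
      · have : B.blue v w = 0 := by
          by_contra h0
          exact B.blue_color v w h0 h
        simp [this]
      · simp [signPoint, hw]
    simp only [this]
    simp [signPoint, hv]
  have pos : ∀ n : V → ℕ, (∀ w, n w ≠ 0 → ε v ≠ ε w) →
      0 < ∏ w, B.second w (signPoint u) ^ n w := fun n hn => by
    refine Finset.prod_pos fun w _ => ?_
    by_cases hw : n w = 0
    · simp [hw]
    · exact pow_pos (B.second_signPoint fun e => hn w hw (h.trans e.symm)) _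
  rw [thirdNum, twoTerm, h1, one_mul]
  exact add_pos (pos _ (B.red_color v)) (pos _ (B.blue_color v))

/-- A curve in the torus that meets the zero set of `first u` at `1`. -/
noncomputable def curve (u : V) (s : ℝˣ) : V ⊕ V → ℝˣ :=
  Sum.elim (fun v => if v ≠ u ∧ ε v = ε u then Units.mk0 2 two_ne_zero else 1)
    (fun v => if v = u then -s else if B.blue u v = 0 then 1 else -1)

theorem continuous_curve (u : V) : Continuous (B.curve u) := by
  refine continuous_pi fun k => ?_
  rcases k with v | v
  · exact continuous_const
  · simp only [curve, elim_inr]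
    split_ifs
    · exact Units.continuous_iff.2 ⟨Units.continuous_val.neg,
        (Units.continuous_val.comp continuous_inv).neg.congr fun s => by simp⟩
    · exact continuous_const
    · exact continuous_const

theorem first_curve_self (u : V) (s : ℝˣ) : B.first u (B.curve u s) = 1 - s := by
  have h : ∀ n : V → ℕ, (∀ w, n w ≠ 0 → ε u ≠ ε w) →
      ∏ w, (B.curve u s (inl w) : ℝ) ^ n w = 1 := fun n hn => by
    refine Finset.prod_eq_one fun w _ => ?_
    by_cases hw : n w = 0
    · simp [hw]
    · simp [curve, (hn w hw).symm]
  rw [first, twoTerm, h _ (B.red_color u), h _ (B.blue_color u)]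
  simp [curve]
  ring

theorem first_curve {u v : V} (hv : v ≠ u) (h : ε v = ε u) (s : ℝˣ) :
    B.first v (B.curve u s) = 1 := by
  have h1 : ∀ n : V → ℕ, (∀ w, n w ≠ 0 → ε v ≠ ε w) →
      ∏ w, (B.curve u s (inl w) : ℝ) ^ n w = 1 := fun n hn => by
    refine Finset.prod_eq_one fun w _ => ?_
    by_cases hw : n w = 0
    · simp [hw]
    · have : ε w ≠ ε u := fun e => hn w hw (h.trans e.symm)
      simp [curve, this]
  have h2 : B.blue u v = 0 := by
    by_contra h0
    exact B.blue_color u v h0 h.symm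
  rw [first, twoTerm, h1 _ (B.red_color v), h1 _ (B.blue_color v)]
  simp [curve, hv, h, h2]
  norm_num

theorem second_curve {u v : V} (h : ε v ≠ ε u) (s : ℝˣ) :
    B.second v (B.curve u s) = (if B.blue u v = 0 then 1 else -1) * (1 - s : ℝ) ^ B.red u v +
      (1 - s : ℝ) ^ B.blue u v := by
  have h1 : ∀ n : V → ℕ, (∀ w, n w ≠ 0 → ε v ≠ ε w) →
      ∏ w, B.first w (B.curve u s) ^ n w = (1 - s : ℝ) ^ n u := fun n hn => by
    rw [Finset.prod_eq_single u, first_curve_self]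
    · intro w _ hw
      by_cases hw' : n w = 0
      · simp [hw']
      · have := hn w hw'
        rw [B.first_curve hw (by omega), one_pow]
    · simp
  have hv : v ≠ u := fun e => h (congrArg ε e)
  rw [second, twoTerm, h1 _ (B.red_color v), h1 _ (B.blue_color v), B.red_symm v u,
    B.blue_symm v u]
  by_cases hb : B.blue u v = 0 <;> simp [curve, hv, h, hb]

theorem prod_second_curve_red (u : V) (s : ℝˣ) :
    ∏ v, B.second v (B.curve u s) ^ B.red u v =
      ∏ v, (1 + (1 - s : ℝ) ^ B.red u v) ^ B.red u v := by
  refine Finset.prod_congr rfl fun v _ => ?_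
  by_cases h : B.red u v = 0
  · simp [h]
  · rw [B.second_curve (B.red_color u v h).symm, ((B.disjoint u v).resolve_left h)]
    simp [add_comm]

theorem prod_second_curve_blue (u : V) (s : ℝˣ) :
    ∏ v, B.second v (B.curve u s) ^ B.blue u v =
      (∏ v, (-1 : ℝ) ^ B.blue u v) * ∏ v, (1 - (1 - s : ℝ) ^ B.blue u v) ^ B.blue u v := by
  rw [← Finset.prod_mul_distrib]
  refine Finset.prod_congr rfl fun v _ => ?_
  by_cases h : B.blue u v = 0
  · simp [h]
  · rw [B.second_curve (B.blue_color u v h).symm, ((B.disjoint u v).resolve_right h), ← mul_pow]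
    congr 1
    simp [h]
    ring

theorem newCoeff_curve (u : V) (s : ℝˣ) :
    (B.newCoeff u (B.curve u s) : ℝ) = -((∏ v, (-1 : ℝ) ^ B.blue u v) / s) := by
  have h : ∀ v, (B.curve u s (inr v) : ℝ) ^ B.blue u v = (-1 : ℝ) ^ B.blue u v := fun v => by
    by_cases hv : B.blue u v = 0
    · simp [hv]
    · have : v ≠ u := fun e => B.blue_color u v hv (by rw [e])
      simp [curve, hv, this]
  simp only [newCoeff, Units.val_div_eq_div_val, Units.coe_prod, Units.val_pow_eq_pow_val, h]
  simp [curve, div_neg]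

/-- The coefficients `-1` at the blue neighbours and the values `2` at the other vertices of the
colour of `u` are chosen so that, up to a common sign, `thirdNum u` is a number at most `1` minus a
number at least `1 / s`. No cancellation can occur, and the gap is at least `1 - s`, the value of
`first u` on the curve. -/
theorem le_abs_thirdNum_curve (u : V) {s : ℝˣ} (hs : 0 < (s : ℝ)) (hs1 : (s : ℝ) < 1) :
    1 - (s : ℝ) ≤ |B.thirdNum u (B.curve u s)| := by
  have e : B.thirdNum u (B.curve u s) = (∏ v, (-1 : ℝ) ^ B.blue u v) *
      (∏ v, (1 - (1 - s : ℝ) ^ B.blue u v) ^ B.blue u v -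
        (∏ v, (1 + (1 - s : ℝ) ^ B.red u v) ^ B.red u v) / s) := by
    rw [thirdNum, twoTerm, prod_second_curve_red, prod_second_curve_blue, newCoeff_curve]
    ring
  have h1 : |∏ v, (-1 : ℝ) ^ B.blue u v| = 1 := by
    rw [Finset.abs_prod]
    exact Finset.prod_eq_one fun v _ => by simp
  have h0 : 0 < 1 - (s : ℝ) := by linarith
  have h2 : ∏ v, (1 - (1 - s : ℝ) ^ B.blue u v) ^ B.blue u v ≤ 1 := by
    have hp : ∀ n : ℕ, (1 - s : ℝ) ^ n ≤ 1 := fun n => pow_le_one₀ h0.le (by linarith)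
    exact Finset.prod_le_one (fun v _ => pow_nonneg (by linarith [hp (B.blue u v)]) _)
      fun v _ => pow_le_one₀ (by linarith [hp (B.blue u v)])
        (by linarith [pow_pos h0 (B.blue u v)])
  have h3 : 1 ≤ ∏ v, (1 + (1 - s : ℝ) ^ B.red u v) ^ B.red u v := by
    refine Finset.prod_induction _ (fun r : ℝ => 1 ≤ r) (fun _ _ => one_le_mul_of_one_le_of_one_le)
      le_rfl fun v _ => one_le_pow₀ ?_
    linarith [pow_pos h0 (B.red u v)]
  -- This rests on `(2 - s) * s = 1 - (1 - s) ^ 2 ≤ 1`.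
  have h4 : 2 - (s : ℝ) ≤ (∏ v, (1 + (1 - s : ℝ) ^ B.red u v) ^ B.red u v) / s := by
    rw [le_div_iff₀ hs]
    nlinarith [sq_nonneg (1 - (s : ℝ))]
  rw [e, abs_mul, h1, one_mul, abs_sub_comm]
  exact le_trans (by linarith) (le_abs_self _)

/-- At the zero of `first u` itself the quotient `thirdNum u / first u` has the form `0 / 0`. Along
the curve it has absolute value at least `1` for `s < 1`, and continuity of `e` carries the bound to
`s = 1`. -/
theorem third_curve_ne_zero {u : V} {e : (V ⊕ V → ℝˣ) → ℝ} (he : e ∈ laurentFn (V ⊕ V))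
    (h : B.thirdNum u = B.first u * e) : e (B.curve u 1) ≠ 0 := by
  have hexp : Continuous fun r : ℝ => Units.mk0 (Real.exp r) (Real.exp_ne_zero r) := by
    rw [Units.continuous_iff]
    refine ⟨Real.continuous_exp, ?_⟩
    simpa [Function.comp_def, ← Real.exp_neg] using Real.continuous_exp.comp continuous_neg
  have hc : Continuous fun r : ℝ =>
      |e (B.curve u (Units.mk0 (Real.exp r) (Real.exp_ne_zero r)))| :=
    ((continuous_of_mem_laurentFn he).comp ((B.continuous_curve u).comp hexp)).abs
  have hle : ∀ r ∈ Set.Iio (0 : ℝ),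
      1 ≤ |e (B.curve u (Units.mk0 (Real.exp r) (Real.exp_ne_zero r)))| := fun r hr => by
    have h1 : Real.exp r < 1 := by simpa using hr
    have := B.le_abs_thirdNum_curve u (s := Units.mk0 (Real.exp r) (Real.exp_ne_zero r))
      (Real.exp_pos r) h1
    rw [h, Pi.mul_apply, first_curve_self, abs_mul, Units.val_mk0,
      abs_of_pos (by linarith : 0 < 1 - Real.exp r)] at this
    exact le_of_mul_le_mul_left (by linarith) (by linarith : 0 < 1 - Real.exp r)
  have h0 : (0 : ℝ) ∈ closure (Set.Iio (0 : ℝ)) := by simp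
  have : 1 ≤ |e (B.curve u (Units.mk0 (Real.exp 0) (Real.exp_ne_zero 0)))| :=
    closure_minimal hle (isClosed_le continuous_const hc) h0
  have h1 : Units.mk0 (Real.exp 0) (Real.exp_ne_zero 0) = 1 := Units.ext Real.exp_zero
  rw [h1] at this
  intro h2
  rw [h2, abs_zero] at this
  linarith

theorem second_nonvanishing {u v : V} (h : ε v ≠ ε u) :
    (fun z => B.second v (B.retract u z)) ≠ 0 :=
  B.nonvanishing_of_eq_zero (B.first_signPoint_self u) (B.second_signPoint h).ne'

theorem third_nonvanishing {u v : V} (h : ε v = ε u) {e : (V ⊕ V → ℝˣ) → ℝ}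
    (he : e ∈ laurentFn (V ⊕ V)) (hv : B.thirdNum v = B.first v * e) :
    (fun z => e (B.retract u z)) ≠ 0 := by
  rcases eq_or_ne v u with rfl | hvu
  · refine B.nonvanishing_of_eq_zero (z := B.curve v 1) ?_ (B.third_curve_ne_zero he hv)
    simp [first_curve_self]
  · refine B.nonvanishing_of_eq_zero (B.first_signPoint_self u) fun h0 => ?_
    have := (B.thirdNum_signPoint hvu h).ne'
    rw [hv, Pi.mul_apply, h0, mul_zero] at this
    exact this rfl

end BipartiteBigraph

namespace BipartiteBigraph

open Sum

/-- The coefficients of the substituted state are Laurent units, so denominators come from the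
values at the vertices only. -/
theorem isLaurentFrac_comp {V : Type*} {M : Submonoid ((V ⊕ V → ℝˣ) → ℝ)}
    (hM : ∀ m ∈ M, m ∈ laurentFn (V ⊕ V)) {S : (V ⊕ V → ℝˣ) → V ⊕ V → ℝ}
    (hpos : ∀ z : V ⊕ V → ℝˣ, (∀ k, 0 < (z k : ℝ)) → ∀ k, 0 < S z k)
    (hr : ∀ v, ∃ m ∈ laurentUnit (V ⊕ V), ∀ z, S z (inr v) = m z)
    (hl : ∀ v, IsLaurentFrac M fun z => S z (inl v))
    (hl' : ∀ v, IsLaurentFrac M fun z => (S z (inl v))⁻¹)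
    {h : (V ⊕ V → ℝ) → ℝ} {f : (V ⊕ V → ℝˣ) → ℝ} (hf : f ∈ laurentFn (V ⊕ V))
    (e : ∀ z : V ⊕ V → ℝˣ, (∀ k, 0 < (z k : ℝ)) → h (fun k => z k) = f z) :
    IsLaurentFrac M fun z => h (S z) := by
  have hk : ∀ k, IsLaurentFrac M fun z => S z k := by
    rintro (v | v)
    · exact hl v
    · obtain ⟨m, hm, e⟩ := hr v
      exact .of_mem hm.1 fun z _ => e z
  have hk' : ∀ k, IsLaurentFrac M fun z => (S z k)⁻¹ := by
    rintro (v | v)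
    · exact hl' v
    · obtain ⟨m, hm, e⟩ := hr v
      exact .of_mem hm.2 fun z _ => by rw [e z]
  obtain ⟨h', ⟨A, hA, m, hm, e'⟩, e''⟩ :=
    IsLaurentFrac.comp hM hf (g := fun k z => S z k) hk hk'
  refine ⟨A, hA, m, hm, fun z hz => ?_⟩
  have hS := hpos z hz
  rw [← e' z hz, e'' z hz (fun k => Units.mk0 (S z k) (hS k).ne') fun k => rfl,
    ← e (fun k => Units.mk0 (S z k) (hS k).ne') hS]
  rfl

variable {V : Type*} [Fintype V] {ε : V → Fin 2} (B : BipartiteBigraph ε)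

/-! ### The Laurent phenomenon -/

theorem step_inl (i : Fin 2) (z : V ⊕ V → ℝˣ) (v : V) :
    B.step i (fun k => z k) (inl v) = if ε v = i then B.first v z else z (inl v) := rfl

theorem step_inr (i : Fin 2) (z : V ⊕ V → ℝˣ) (v : V) :
    B.step i (fun k => z k) (inr v) = ((if ε v = i then B.newCoeff v z else z (inr v) : ℝˣ) : ℝ) := by
  simp only [step, elim_inr]
  split_ifs <;> simp [newCoeff]

theorem two_steps_inl (i : Fin 2) (z : V ⊕ V → ℝˣ) (v : V) :
    B.step (i + 1) (B.step i fun k => z k) (inl v) =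
      if ε v = i then B.first v z else B.second v z := by
  by_cases hv : ε v = i
  · have h : ε v ≠ i + 1 := by omega
    simp only [hv, if_true]
    rw [step, elim_inl, if_neg h, step_inl, if_pos hv]
  · have h : ε v = i + 1 := by omega
    have hw : ∀ w, ε w ≠ ε v → B.step i (fun k => z k) (inl w) = B.first w z := fun w hw => by
      rw [step_inl, if_pos (by omega)]
    rw [step, elim_inl, if_pos h, twoTerm_congr hw, step_inl, step_inr, if_neg hv, if_neg hv,
      if_neg hv]
    rfl

theorem three_steps_inl (i : Fin 2) (z : V ⊕ V → ℝˣ) (v : V) :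
    B.step i (B.step (i + 1) (B.step i fun k => z k)) (inl v) =
      if ε v = i then B.thirdNum v z / B.first v z else B.second v z := by
  by_cases hv : ε v = i
  · have h : ε v ≠ i + 1 := by omega
    have hw : ∀ w, ε w ≠ ε v → B.step (i + 1) (B.step i fun k => z k) (inl w) =
        B.second w z := fun w hw => by
      rw [two_steps_inl, if_neg (by omega)]
    have hc : B.step (i + 1) (B.step i fun k => z k) (inr v) = B.newCoeff v z := by
      rw [step, elim_inr, if_neg h, step_inr, if_pos hv]
    rw [step, elim_inl, if_pos hv, twoTerm_congr hw, two_steps_inl, hc, if_pos hv, if_pos hv]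
    rfl
  · rw [step, elim_inl, if_neg hv, two_steps_inl, if_neg hv, if_neg hv]

theorem exists_unit_step_inr (i : Fin 2) {S : (V ⊕ V → ℝˣ) → V ⊕ V → ℝ}
    (hS : ∀ v, ∃ m ∈ laurentUnit (V ⊕ V), ∀ z, S z (inr v) = m z) (v : V) :
    ∃ m ∈ laurentUnit (V ⊕ V), ∀ z, B.step i (S z) (inr v) = m z := by
  choose m hm e using hS
  by_cases h : ε v = i
  · refine ⟨_, div_mem (prod_pow_mem_laurentUnit hm (B.blue v)) (hm v), fun z => ?_⟩
    simp [step, h, e]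
  · exact ⟨m v, hm v, fun z => by simp [step, h, e]⟩

/-- The monoid generated by the values at the vertices of colour `i` after one step. -/
def denomOne (i : Fin 2) : Submonoid ((V ⊕ V → ℝˣ) → ℝ) :=
  Submonoid.closure {f | ∃ u, ε u = i ∧ f = B.first u}

/-- The monoid generated by all values after three steps. -/
def denomThree (i : Fin 2) : Submonoid ((V ⊕ V → ℝˣ) → ℝ) :=
  Submonoid.closure ({f | ∃ v, ε v ≠ i ∧ f = B.second v} ∪
    {f | f ∈ laurentFn (V ⊕ V) ∧ ∃ u, ε u = i ∧ B.thirdNum u = B.first u * f})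

theorem denomOne_le (i : Fin 2) : ∀ m ∈ B.denomOne i, m ∈ laurentFn (V ⊕ V) := by
  have : B.denomOne i ≤ (laurentFn (V ⊕ V)).toSubsemiring.toSubmonoid := by
    refine Submonoid.closure_le.2 ?_
    rintro _ ⟨u, -, rfl⟩
    exact B.first_mem u
  exact this

theorem denomThree_le (i : Fin 2) : ∀ m ∈ B.denomThree i, m ∈ laurentFn (V ⊕ V) := by
  have : B.denomThree i ≤ (laurentFn (V ⊕ V)).toSubsemiring.toSubmonoid := by
    refine Submonoid.closure_le.2 ?_
    rintro _ (⟨v, -, rfl⟩ | ⟨h, -⟩)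
    · exact B.second_mem v
    · exact h
  exact this

theorem denomOne_pos {i : Fin 2} {m : (V ⊕ V → ℝˣ) → ℝ} (hm : m ∈ B.denomOne i)
    {z : V ⊕ V → ℝˣ} (hz : ∀ k, 0 < (z k : ℝ)) : 0 < m z := by
  induction hm using Submonoid.closure_induction with
  | mem f hf =>
    obtain ⟨u, -, rfl⟩ := hf
    exact B.first_pos hz
  | one => simp
  | mul f g _ _ hf hg => exact mul_pos hf hg

variable [DecidableEq V]

theorem denomThree_nonvanishing {u : V} {m : (V ⊕ V → ℝˣ) → ℝ} (hm : m ∈ B.denomThree (ε u)) :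
    (fun z => m (B.retract u z)) ≠ 0 := by
  induction hm using Submonoid.closure_induction with
  | mem f hf =>
    rcases hf with ⟨v, hv, rfl⟩ | ⟨hf, v, hv, e⟩
    · exact B.second_nonvanishing hv
    · exact B.third_nonvanishing hv hf e
  | one => exact fun h => one_ne_zero (α := ℝ) (congrFun h 1)
  | mul f g hf hg ihf ihg =>
    exact fun h => (eq_zero_or_eq_zero_of_mem_laurentFn
      (B.comp_retract_mem u (B.denomThree_le _ f hf))
      (B.comp_retract_mem u (B.denomThree_le _ g hg)) h).elim ihf ihg

/-- The factors of `m` are removed one at a time: on the zero set of a factor `first u` the product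
`A * n` vanishes while `n` does not vanish identically, so `A` vanishes there and is divisible by
`first u`. -/
theorem exists_eq_mul_denomOne {i : Fin 2} {m : (V ⊕ V → ℝˣ) → ℝ} (hm : m ∈ B.denomOne i)
    {A C n : (V ⊕ V → ℝˣ) → ℝ} (hA : A ∈ laurentFn (V ⊕ V)) (hC : C ∈ laurentFn (V ⊕ V))
    (hn : n ∈ B.denomThree i) (h : A * n = C * m) : ∃ D ∈ laurentFn (V ⊕ V), A = D * m := by
  induction hm using Submonoid.closure_induction generalizing A C with
  | mem f hf =>
    obtain ⟨u, rfl, rfl⟩ := hf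
    have h0 : (fun z => A (B.retract u z)) * (fun z => n (B.retract u z)) = 0 := by
      ext z
      have := congrFun h (B.retract u z)
      simpa [B.first_retract] using this
    have hA0 := (eq_zero_or_eq_zero_of_mem_laurentFn (B.comp_retract_mem u hA)
      (B.comp_retract_mem u (B.denomThree_le _ n hn)) h0).resolve_right
      (B.denomThree_nonvanishing hn)
    obtain ⟨D, hD, e⟩ := B.exists_eq_first_mul u hA fun z => congrFun hA0 z
    exact ⟨D, hD, e.trans (mul_comm _ _)⟩
  | one => exact ⟨A, hA, (mul_one A).symm⟩
  | mul f g hf hg ihf ihg =>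
    have hf' := B.denomOne_le i f hf
    obtain ⟨D, hD, rfl⟩ := ihg hA (mul_mem hC hf') (by rw [h, mul_assoc])
    have h' : D * n = C * f := by
      -- The factor `g` may have zeros on the torus, so it is cancelled on the positive orthant,
      -- where it has none.
      refine eq_of_eq_on_pos (mul_mem hD (B.denomThree_le i n hn)) (mul_mem hC hf')
        fun z hz => ?_
      have := congrFun h z
      simp only [Pi.mul_apply] at this ⊢
      refine mul_right_cancel₀ (B.denomOne_pos hg hz).ne' ?_
      linear_combination this
    obtain ⟨E, hE, rfl⟩ := ihf hD hC h'
    exact ⟨E, hE, mul_assoc _ _ _⟩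

/-- The Laurent phenomenon for the T-system with coefficients. -/
theorem alternate_laurent (n : ℕ) (i : Fin 2) (v : V) : ∃ f ∈ laurentFn (V ⊕ V),
    ∀ z : V ⊕ V → ℝˣ, (∀ k, 0 < (z k : ℝ)) → B.alternate n i (fun k => z k) (inl v) = f z := by
  induction n using Nat.strong_induction_on generalizing i with
  | _ n ih =>
  match n, ih with
  | 0, _ => exact ⟨_, coord_mem_laurentFn (inl v), fun z _ => rfl⟩
  | 1, _ =>
    by_cases h : ε v = i
    · exact ⟨_, B.first_mem v, fun z _ => by rw [alternate, alternate, step_inl, if_pos h]⟩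
    · exact ⟨_, coord_mem_laurentFn (inl v), fun z _ => by
        rw [alternate, alternate, step_inl, if_neg h]⟩
  | 2, _ =>
    by_cases h : ε v = i
    · exact ⟨_, B.first_mem v, fun z _ => by
        rw [alternate, alternate, alternate, two_steps_inl, if_pos h]⟩
    · exact ⟨_, B.second_mem v, fun z _ => by
        rw [alternate, alternate, alternate, two_steps_inl, if_neg h]⟩
  | n + 3, ih =>
    have hi : i + 1 + 1 = i := by omega
    obtain ⟨f₁, hf₁, e₁⟩ := ih (n + 2) (by omega) (i + 1)
    obtain ⟨f₃, hf₃, e₃⟩ := ih n (by omega) (i + 1)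
    have hr₀ : ∀ v, ∃ m ∈ laurentUnit (V ⊕ V), ∀ z : V ⊕ V → ℝˣ, (z (inr v) : ℝ) = m z :=
      fun v => ⟨_, coord_mem_laurentUnit (inr v), fun z => rfl⟩
    have hr₁ := B.exists_unit_step_inr i (S := fun z k => z k) hr₀
    have hr₃ := B.exists_unit_step_inr i (B.exists_unit_step_inr (i + 1) hr₁)
    -- The remaining `n + 2` steps are Laurent in the state after one step, by induction.
    have H₁ : IsLaurentFrac (B.denomOne i) fun z =>
        B.alternate (n + 2) (i + 1) (B.step i fun k => z k) (inl v) := by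
      refine isLaurentFrac_comp (B.denomOne_le i) (S := fun z => B.step i fun k => z k)
        (h := fun z => B.alternate (n + 2) (i + 1) z (inl v))
        (fun z hz => B.step_pos hz) hr₁ (fun w => ?_) (fun w => ?_) hf₁ e₁
      · by_cases h : ε w = i
        · exact .of_mem (B.first_mem w) fun z _ => by rw [step_inl, if_pos h]
        · exact .of_mem (coord_mem_laurentFn (inl w)) fun z _ => by rw [step_inl, if_neg h]
      · by_cases h : ε w = i
        · refine ⟨1, one_mem _, B.first w, Submonoid.subset_closure ⟨w, h, rfl⟩, fun z hz => ?_⟩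
          beta_reduce
          rw [step_inl, if_pos h, inv_mul_cancel₀ (B.first_pos hz).ne', Pi.one_apply]
        · exact .of_mem (coord_inv_mem_laurentFn (inl w)) fun z _ => by rw [step_inl, if_neg h]
    -- The remaining `n` steps are Laurent in the state after three steps, which itself consists of
    -- Laurent functions by `exists_third`.
    have H₃ : IsLaurentFrac (B.denomThree i) fun z =>
        B.alternate n (i + 1) (B.step i (B.step (i + 1) (B.step i fun k => z k))) (inl v) := by
      have hpos : ∀ z : V ⊕ V → ℝˣ, (∀ k, 0 < (z k : ℝ)) → ∀ k,
          0 < B.step i (B.step (i + 1) (B.step i fun k => z k)) k :=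
        fun z hz => B.step_pos (B.step_pos (B.step_pos hz))
      have hl : ∀ w, ∃ e ∈ laurentFn (V ⊕ V), e ∈ B.denomThree i ∧ ∀ z : V ⊕ V → ℝˣ,
          (∀ k, 0 < (z k : ℝ)) →
            B.step i (B.step (i + 1) (B.step i fun k => z k)) (inl w) = e z := fun w => by
        by_cases h : ε w = i
        · obtain ⟨e, he, he'⟩ := B.exists_third w
          refine ⟨e, he, Submonoid.subset_closure (Or.inr ⟨he, w, h, he'⟩), fun z hz => ?_⟩
          rw [three_steps_inl, if_pos h, he', Pi.mul_apply,
            mul_div_cancel_left₀ _ (B.first_pos hz).ne']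
        · refine ⟨B.second w, B.second_mem w, Submonoid.subset_closure (Or.inl ⟨w, h, rfl⟩),
            fun z hz => ?_⟩
          rw [three_steps_inl, if_neg h]
      refine isLaurentFrac_comp (B.denomThree_le i)
        (S := fun z => B.step i (B.step (i + 1) (B.step i fun k => z k)))
        (h := fun z => B.alternate n (i + 1) z (inl v)) hpos hr₃ (fun w => ?_) (fun w => ?_)
        hf₃ e₃
      · obtain ⟨e, he, -, h⟩ := hl w
        exact .of_mem he h
      · obtain ⟨e, he, hm, h⟩ := hl w
        refine ⟨1, one_mem _, e, hm, fun z hz => ?_⟩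
        rw [← h z hz, inv_mul_cancel₀ (hpos z hz _).ne', Pi.one_apply]
    obtain ⟨A, hA, m, hm, hAm⟩ := H₁
    obtain ⟨C, hC, n', hn, hCn⟩ := H₃
    have key : A * n' = C * m := by
      refine eq_of_eq_on_pos (mul_mem hA (B.denomThree_le i _ hn))
        (mul_mem hC (B.denomOne_le i _ hm)) fun z hz => ?_
      have hA' := hAm z hz
      have hC' := hCn z hz
      simp only [alternate, hi] at hA' hC'
      rw [Pi.mul_apply, Pi.mul_apply, ← hA', ← hC']
      ring
    obtain ⟨D, hD, rfl⟩ := B.exists_eq_mul_denomOne hm hA hC hn key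
    refine ⟨D, hD, fun z hz => ?_⟩
    rw [alternate]
    exact mul_right_cancel₀ (B.denomOne_pos hm hz).ne' (hAm z hz)

end BipartiteBigraph

namespace ClusterQuiver

variable {V : Type*}

/-- Parametricity of the recurrence: a relation preserved by the update persists at all times. It is
used to carry the T-system from rational functions to functions of `L`, and then to evaluate at `L`.
-/
theorem labelAt_rel {X Y : Type*} {ε : V → Fin 2} {f : (V → X) → V → X} {g : (V → Y) → V → Y}
    (r : X → Y → Prop)
    (h : ∀ L L', (∀ v, r (L v) (L' v)) → ∀ v, r (f L v) (g L' v))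
    {x : V → X} {y : V → Y} (h0 : ∀ v, r (x v) (y v)) (t : ℤ) (v : V) :
    r (labelAt ε f x t v) (labelAt ε g y t v) := by
  have fwd : ∀ (n : ℕ) v, r (forwardLabel ε f x n v) (forwardLabel ε g y n v) := by
    intro n
    induction n with
    | zero => exact h0
    | succ n ih =>
      intro v
      simp only [forwardLabel]
      split_ifs
      · exact h _ _ ih v
      · exact ih v
  have bwd : ∀ (n : ℕ) v, r (backwardLabel ε f x n v) (backwardLabel ε g y n v) := by
    intro n
    induction n with
    | zero => exact h0
    | succ n ih =>
      intro v
      simp only [backwardLabel]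
      split_ifs
      · exact h _ _ ih v
      · exact ih v
  rcases t with n | n
  · exact fwd n v
  · exact bwd (n + 1) v

/-! ### The dynamics as a group of permutations -/

section Flips

variable {ε : V → Fin 2} {E : (V → ℝ) → V → ℝ}

/-- The value of `E L` at `v` depends on the labels of the vertices of the other colour only. -/
def IsLocal (ε : V → Fin 2) (E : (V → ℝ) → V → ℝ) : Prop :=
  ∀ v L L', (∀ w, ε w ≠ ε v → L w = L' w) → E L v = E L' v

/-- The combined update of all vertices of colour `i`. -/
def flip (hE : IsLocal ε E) (i : Fin 2) : Equiv.Perm (V → ℝ) :=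
  Function.Involutive.toPerm (fun L v => if ε v = i then E L v - L v else L v) fun L => by
    ext v
    by_cases hv : ε v = i
    · simp only [hv, if_true]
      rw [hE v (fun v => if ε v = i then E L v - L v else L v) L fun w hw =>
        if_neg fun h => hw (h.trans hv.symm)]
      ring
    · simp [hv]

theorem flip_apply (hE : IsLocal ε E) (i : Fin 2) (L : V → ℝ) (v : V) :
    flip hE i L v = if ε v = i then E L v - L v else L v := rfl

theorem flip_flip (hE : IsLocal ε E) (i : Fin 2) (L : V → ℝ) : flip hE i (flip hE i L) = L :=
  (flip hE i).left_inv L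

theorem flip_mul_self (hE : IsLocal ε E) (i : Fin 2) : flip hE i * flip hE i = 1 :=
  Equiv.ext (flip_flip hE i)

theorem flip_inv (hE : IsLocal ε E) (i : Fin 2) : (flip hE i)⁻¹ = flip hE i :=
  inv_eq_of_mul_eq_one_left (flip_mul_self hE i)

/-- The passage from time `t` to time `t + 2` for even `t`. -/
def shift (hE : IsLocal ε E) : Equiv.Perm (V → ℝ) := flip hE 1 * flip hE 0

theorem shift_inv (hE : IsLocal ε E) : (shift hE)⁻¹ = flip hE 0 * flip hE 1 := by
  rw [shift, mul_inv_rev, flip_inv, flip_inv]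

/-- The two flips are involutions whose product is the shift, so they satisfy the dihedral
relations. -/
theorem flip_conj_shift (hE : IsLocal ε E) (i : Fin 2) :
    flip hE i * shift hE * (flip hE i)⁻¹ = (shift hE)⁻¹ := by
  rw [shift_inv, flip_inv, shift]
  fin_cases i
  · change flip hE 0 * (flip hE 1 * flip hE 0) * flip hE 0 = _
    rw [mul_assoc, mul_assoc, flip_mul_self, mul_one]
  · change flip hE 1 * (flip hE 1 * flip hE 0) * flip hE 1 = _
    rw [← mul_assoc, flip_mul_self, one_mul]

theorem shift_zpow_flip (hE : IsLocal ε E) (N : ℤ) (i : Fin 2) (L : V → ℝ) :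
    (shift hE ^ N) (flip hE i L) = flip hE i ((shift hE ^ N)⁻¹ L) := by
  have h : flip hE i * (shift hE ^ N)⁻¹ = shift hE ^ N * flip hE i := by
    rw [← inv_zpow, ← flip_conj_shift hE i, conj_zpow, flip_inv, ← mul_assoc, ← mul_assoc,
      flip_mul_self, one_mul]
  exact (Equiv.congr_fun h L).symm

theorem eps_parity_iff (t : ℤ) (v : V) :
    Even (t + eps ε v) ↔ ε v = if Even t then 0 else 1 := by
  have : eps ε v = 0 ∧ ε v = 0 ∨ eps ε v = 1 ∧ ε v = 1 := by
    simp only [eps]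
    omega
  rcases this with ⟨h, h'⟩ | ⟨h, h'⟩ <;> rw [h, h']
  · by_cases ht : Even t <;> simp [ht]
  · rw [Int.even_add_one]
    by_cases ht : Even t
    · rw [if_pos ht]
      exact iff_of_false (not_not.2 ht) (by decide)
    · rw [if_neg ht]
      exact iff_of_true ht rfl

theorem labelAt_add_one (hE : IsLocal ε E) (x : V → ℝ) (t : ℤ) :
    labelAt ε (fun L v => E L v - L v) x (t + 1) =
      flip hE (if Even t then 0 else 1) (labelAt ε (fun L v => E L v - L v) x t) := by
  obtain ⟨h1, h2⟩ := labelAt_step ε (fun L v => E L v - L v) x t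
  simp only [eps_parity_iff] at h1 h2
  rcases h2 with h2 | h2
  · ext v
    rw [flip_apply]
    by_cases h : ε v = if Even t then 0 else 1
    · rw [if_pos h, h2 v h]
    · rw [if_neg h, h1 v h]
  · rw [← flip_flip hE (if Even t then 0 else 1) (labelAt ε _ x (t + 1))]
    congr 1
    ext v
    rw [flip_apply]
    by_cases h : ε v = if Even t then 0 else 1
    · rw [if_pos h, h2 v h]
    · rw [if_neg h, h1 v h]

theorem labelAt_two_mul (hE : IsLocal ε E) (x : V → ℝ) (N : ℤ) :
    labelAt ε (fun L v => E L v - L v) x (2 * N) = (shift hE ^ N) x := by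
  have step : ∀ n : ℤ, labelAt ε (fun L v => E L v - L v) x (2 * (n + 1)) =
      shift hE (labelAt ε (fun L v => E L v - L v) x (2 * n)) := fun n => by
    have e : 2 * (n + 1) = 2 * n + 1 + 1 := by ring
    have h : Even (2 * n) := even_two_mul n
    rw [e, labelAt_add_one hE, labelAt_add_one hE, if_pos h,
      if_neg (by rwa [Int.even_add_one, not_not])]
    rfl
  induction N using Int.induction_on with
  | zero => rfl
  | succ n ih => rw [step, ih, add_comm, zpow_add, zpow_one, Equiv.Perm.mul_apply]
  | pred n ih =>
    have := step (-(n : ℤ) - 1)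
    rw [sub_add_cancel, ih] at this
    rw [sub_eq_neg_add, zpow_add, zpow_neg_one, Equiv.Perm.mul_apply, this,
      Equiv.Perm.inv_def, Equiv.symm_apply_apply, ← sub_eq_neg_add]

/-- For a black vertex the time is `1 + 2N`; the last step from the even time `2N` updates white
vertices only, so the label is the one at time `2N`. -/
theorem labelAt_eps_add (hE : IsLocal ε E) (x : V → ℝ) (N : ℤ) (v : V) :
    labelAt ε (fun L v => E L v - L v) x (eps ε v + 2 * N) v = (shift hE ^ N) x v := by
  have : eps ε v = 0 ∧ ε v = 0 ∨ eps ε v = 1 ∧ ε v = 1 := by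
    simp only [eps]
    omega
  rcases this with ⟨h, h'⟩ | ⟨h, h'⟩
  · rw [h, zero_add, labelAt_two_mul hE]
  · rw [h, add_comm, labelAt_add_one hE, if_pos (even_two_mul N), flip_apply, h',
      if_neg (by decide), labelAt_two_mul hE]

theorem labelAt_periodic (hE : IsLocal ε E) {x : V → ℝ} {N : ℤ} (h : (shift hE ^ N) x = x)
    (t : ℤ) : labelAt ε (fun L v => E L v - L v) x (t + 2 * N) =
      labelAt ε (fun L v => E L v - L v) x t := by
  have step : ∀ n : ℤ, labelAt ε (fun L v => E L v - L v) x (n + 1 + 2 * N) =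
      flip hE (if Even n then 0 else 1)
        (labelAt ε (fun L v => E L v - L v) x (n + 2 * N)) := fun n => by
    have e : n + 1 + 2 * N = n + 2 * N + 1 := by ring
    have h : Even (n + 2 * N) ↔ Even n := by simp [Int.even_add]
    rw [e, labelAt_add_one hE]
    simp only [h]
  induction t using Int.induction_on with
  | zero => rw [zero_add, labelAt_two_mul hE, h]; rfl
  | succ n ih => rw [step, ih, labelAt_add_one hE]
  | pred n ih =>
    have h1 := step (-(n : ℤ) - 1)
    have h2 := labelAt_add_one hE x (-(n : ℤ) - 1)
    rw [sub_add_cancel] at h1 h2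
    rw [h1, h2] at ih
    exact (flip hE _).injective ih

/-- The permutations commuting with the multiplication by nonnegative numbers. -/
def posHomogeneous (V : Type*) : Subgroup (Equiv.Perm (V → ℝ)) where
  carrier := {T | ∀ s : ℝ, 0 ≤ s → ∀ l, T (s • l) = s • T l}
  one_mem' s _ l := rfl
  mul_mem' {S T} hS hT s hs l := by
    rw [Equiv.Perm.mul_apply, hT s hs, hS s hs, Equiv.Perm.mul_apply]
  inv_mem' {T} hT s hs l := by
    rw [Equiv.Perm.inv_eq_iff_eq, hT s hs, Equiv.Perm.inv_def, Equiv.apply_symm_apply]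

/-- Pairs of permutations which map labelings at bounded distance to labelings at bounded
distance. -/
def closePairs (V : Type*) : Submonoid (Equiv.Perm (V → ℝ) × Equiv.Perm (V → ℝ)) where
  carrier := {T | ∀ C : ℝ, ∃ D : ℝ, ∀ L l : V → ℝ, (∀ v, |L v - l v| ≤ C) →
    ∀ v, |T.1 L v - T.2 l v| ≤ D}
  one_mem' C := ⟨C, fun _ _ h => h⟩
  mul_mem' {S T} hS hT C := by
    obtain ⟨D, hD⟩ := hT C
    obtain ⟨D', hD'⟩ := hS D
    exact ⟨D', fun L l h => hD' _ _ (hD L l h)⟩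

/-- `closePairs` is not assumed closed under inverses; negative powers are covered because the
inverse shift is again a product of flips. -/
theorem shift_zpow_mem_closePairs {E' : (V → ℝ) → V → ℝ} {hE : IsLocal ε E}
    {hE' : IsLocal ε E'} (h : ∀ i, (flip hE i, flip hE' i) ∈ closePairs V) (N : ℤ) :
    (shift hE ^ N, shift hE' ^ N) ∈ closePairs V := by
  rcases N with n | n
  · simpa [shift] using pow_mem (mul_mem (h 1) (h 0)) n
  · have := pow_mem (mul_mem (h 0) (h 1)) (n + 1)
    rw [zpow_negSucc, zpow_negSucc, ← inv_pow, ← inv_pow, shift_inv, shift_inv]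
    exact this

/-- At the vertices of the colour of `u` the exchange term sees only the other colour, where
`Pi.single u 1` is zero. -/
theorem flip_single [DecidableEq V] (hE : IsLocal ε E) (h0 : ∀ v, E 0 v = 0) (u : V) :
    flip hE (ε u) (Pi.single u 1) = -Pi.single u 1 := by
  ext v
  rw [flip_apply]
  split_ifs with hv
  · rw [hE v (Pi.single u 1) 0, h0, zero_sub, Pi.neg_apply]
    intro w hw
    have : w ≠ u := fun e => hw (by rw [e, hv])
    simp [this]
  · have : v ≠ u := fun e => hv (by rw [e])
    simp [this]

theorem shift_zpow_neg_single [DecidableEq V] (hE : IsLocal ε E) (h0 : ∀ v, E 0 v = 0)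
    {N : ℤ} {u : V} (h : (shift hE ^ N) (Pi.single u 1) = Pi.single u 1) :
    (shift hE ^ N) (-Pi.single u 1) = -Pi.single u 1 := by
  rw [← flip_single hE h0, shift_zpow_flip, Equiv.Perm.inv_eq_iff_eq.2 h.symm]

end Flips

/-! ### One-variable polynomials -/

/-- The bound near `0` forces vanishing at `0`, so a factor `X` can be split off `m` times; the
bound at infinity then makes the remaining bounded polynomial constant. -/
theorem polynomial_eq_monomial_of_bound {K : ℝ} (m : ℕ) (P : Polynomial ℝ)
    (h : ∀ s : ℝ, 0 < s → |P.eval s| ≤ K * s ^ m) : ∃ a : ℝ, ∀ s, P.eval s = a * s ^ m := by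
  induction m generalizing P with
  | zero =>
    have : P.degree ≤ 0 := by
      rw [← Polynomial.isBoundedUnder_abs_atTop_iff]
      refine ⟨K, Filter.eventually_map.2 ?_⟩
      filter_upwards [Filter.eventually_gt_atTop 0] with s hs
      simpa using h s hs
    exact ⟨P.coeff 0, fun s => by
      rw [Polynomial.eq_C_of_degree_le_zero this]
      simp⟩
  | succ m ih =>
    have h0 : P.eval 0 = 0 := by
      have h1 : Filter.Tendsto (fun s : ℝ => |P.eval s|) (nhdsWithin 0 (Set.Ioi 0))
          (nhds |P.eval 0|) :=
        (P.continuous.abs.tendsto 0).mono_left nhdsWithin_le_nhds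
      have h2 : Filter.Tendsto (fun s : ℝ => K * s ^ (m + 1)) (nhdsWithin 0 (Set.Ioi 0))
          (nhds (K * 0 ^ (m + 1))) :=
        ((by fun_prop : Continuous fun s : ℝ => K * s ^ (m + 1)).tendsto 0).mono_left
          nhdsWithin_le_nhds
      have h3 := le_of_tendsto_of_tendsto h1 h2
        (Filter.eventually_of_mem self_mem_nhdsWithin fun s hs => h s hs)
      simpa using h3
    obtain ⟨R, rfl⟩ := Polynomial.X_dvd_iff.2 ((Polynomial.coeff_zero_eq_eval_zero P).trans h0)
    obtain ⟨a, ha⟩ := ih R fun s hs => by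
      have := h s hs
      rw [Polynomial.eval_mul, Polynomial.eval_X, abs_mul, abs_of_pos hs] at this
      refine le_of_mul_le_mul_left (this.trans_eq ?_) hs
      ring
    exact ⟨a, fun s => by
      rw [Polynomial.eval_mul, Polynomial.eval_X, ha]
      ring⟩

end ClusterQuiver

namespace ClusterQuiver

variable {V : Type*} [Fintype V] {Q : ClusterQuiver V} {ε : V → Fin 2}

/-! ### The T-system in logarithmic coordinates and its tropicalization -/

/-- The logarithm of the right-hand side of the T-system relation in logarithmic coordinates. -/
noncomputable def logExchange (Q : ClusterQuiver V) (L : V → ℝ) (v : V) : ℝ :=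
  Real.log (Q.exchange (fun w => Real.exp (L w)) v)

theorem exchange_exp (L : V → ℝ) (v : V) : Q.exchange (fun w => Real.exp (L w)) v =
    Real.exp (∑ u, (Q.arrows u v : ℝ) * L u) + Real.exp (∑ w, (Q.arrows v w : ℝ) * L w) := by
  simp only [exchange, Real.exp_sum, Real.exp_nat_mul]

theorem exchange_pos {x : V → ℝ} (hx : ∀ w, 0 < x w) (v : V) : 0 < Q.exchange x v :=
  add_pos (Finset.prod_pos fun w _ => pow_pos (hx w) _)
    (Finset.prod_pos fun w _ => pow_pos (hx w) _)

theorem exp_logExchange (L : V → ℝ) (v : V) :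
    Real.exp (Q.logExchange L v) = Q.exchange (fun w => Real.exp (L w)) v :=
  Real.exp_log (exchange_pos (fun _ => Real.exp_pos _) v)

theorem IsBipartition.isLocal_tropicalExchange (hε : Q.IsBipartition ε) :
    IsLocal ε Q.tropicalExchange := fun v _ _ h =>
  tropicalExchange_congr (fun u hu => h u (hε u v hu)) (fun u hu => h u (hε v u hu).symm)

theorem IsBipartition.isLocal_logExchange (hε : Q.IsBipartition ε) :
    IsLocal ε Q.logExchange := fun v _ _ h => congrArg Real.log
  (exchange_congr (fun u hu => congrArg Real.exp (h u (hε u v hu)))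
    (fun u hu => congrArg Real.exp (h u (hε v u hu).symm)))

/-- From `exp (max a b) ≤ exp a + exp b ≤ 2 * exp (max a b)`. This is the only comparison needed
between the T-system relation and its tropical form. -/
theorem abs_log_exp_add_exp_sub_max_le {a b a' b' C : ℝ} (ha : |a - a'| ≤ C) (hb : |b - b'| ≤ C) :
    |Real.log (Real.exp a + Real.exp b) - max a' b'| ≤ Real.log 2 + C := by
  have h2 : (0 : ℝ) ≤ Real.log 2 := Real.log_nonneg (by norm_num)
  have hmax : |max a b - max a' b'| ≤ C := (abs_max_sub_max_le_max a b a' b').trans (max_le ha hb)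
  have hlow : max a b ≤ Real.log (Real.exp a + Real.exp b) := by
    rw [Real.le_log_iff_exp_le (add_pos (Real.exp_pos a) (Real.exp_pos b))]
    rcases max_choice a b with h | h <;> rw [h]
    · linarith [Real.exp_pos b]
    · linarith [Real.exp_pos a]
  have hup : Real.log (Real.exp a + Real.exp b) ≤ Real.log 2 + max a b := by
    rw [Real.log_le_iff_le_exp (add_pos (Real.exp_pos a) (Real.exp_pos b)), Real.exp_add,
      Real.exp_log two_pos]
    linarith [Real.exp_le_exp.2 (le_max_left a b), Real.exp_le_exp.2 (le_max_right a b)]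
  rw [abs_le] at hmax ⊢
  constructor <;> linarith

theorem abs_sum_sub_sum_le {n : V → ℕ} {L l : V → ℝ} {C : ℝ} (h : ∀ v, |L v - l v| ≤ C) :
    |∑ u, (n u : ℝ) * L u - ∑ u, (n u : ℝ) * l u| ≤ ∑ u, (n u : ℝ) * C := by
  rw [← Finset.sum_sub_distrib]
  refine (Finset.abs_sum_le_sum_abs _ _).trans (Finset.sum_le_sum fun u _ => ?_)
  rw [← mul_sub, abs_mul, Nat.abs_cast]
  exact mul_le_mul_of_nonneg_left (h u) (Nat.cast_nonneg _)

theorem flip_mem_closePairs (hE : IsLocal ε Q.logExchange) (hE' : IsLocal ε Q.tropicalExchange)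
    (i : Fin 2) : (flip hE i, flip hE' i) ∈ closePairs V := by
  intro C
  set K : V → ℝ := fun v => (∑ u, (Q.arrows u v : ℝ) * |C|) + ∑ u, (Q.arrows v u : ℝ) * |C|
    with hK
  have hs : ∀ n : V → ℕ, 0 ≤ ∑ u, (n u : ℝ) * |C| := fun n =>
    Finset.sum_nonneg fun u _ => mul_nonneg (Nat.cast_nonneg _) (abs_nonneg C)
  have hK0 : ∀ v, 0 ≤ K v := fun v => add_nonneg (hs _) (hs _)
  refine ⟨Real.log 2 + ∑ v, K v + |C|, fun L l h v => ?_⟩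
  have h2 : (0 : ℝ) ≤ Real.log 2 := Real.log_nonneg (by norm_num)
  have hKv : K v ≤ ∑ v, K v := Finset.single_le_sum (fun v _ => hK0 v) (Finset.mem_univ v)
  have hC : ∀ v, |L v - l v| ≤ |C| := fun v => (h v).trans (le_abs_self C)
  have key : |Q.logExchange L v - Q.tropicalExchange l v| ≤ Real.log 2 + K v := by
    rw [logExchange, exchange_exp]
    exact abs_log_exp_add_exp_sub_max_le
      ((abs_sum_sub_sum_le hC).trans (le_add_of_nonneg_right (hs _)))
      ((abs_sum_sub_sum_le hC).trans (le_add_of_nonneg_left (hs _)))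
  have hv := hC v
  simp only [flip_apply]
  rw [abs_le] at key hv
  split_ifs
  · rw [abs_le]
    constructor <;> linarith
  · exact (hC v).trans (by linarith [hK0 v])

theorem flip_mem_posHomogeneous (hE : IsLocal ε Q.tropicalExchange) (i : Fin 2) :
    flip hE i ∈ posHomogeneous V := by
  intro s hs l
  ext v
  have h : Q.tropicalExchange (s • l) v = s * Q.tropicalExchange l v := by
    simp only [tropicalExchange, mul_max_of_nonneg _ _ hs, Finset.mul_sum, Pi.smul_apply,
      smul_eq_mul, mul_left_comm]
  simp only [flip_apply, h, Pi.smul_apply, smul_eq_mul]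
  split_ifs
  · ring
  · rfl

theorem shift_zpow_smul (hE : IsLocal ε Q.tropicalExchange) (N : ℤ) {s : ℝ} (hs : 0 ≤ s)
    (l : V → ℝ) : (shift hE ^ N) (s • l) = s • (shift hE ^ N) l :=
  zpow_mem (mul_mem (flip_mem_posHomogeneous hE 1) (flip_mem_posHomogeneous hE 0)) N s hs l

theorem tropicalExchange_zero (v : V) : Q.tropicalExchange 0 v = 0 := by
  simp [tropicalExchange]

/-! ### The Laurent phenomenon in logarithmic coordinates -/

variable [DecidableEq V]

theorem bigraph_twoTerm (hε : Q.IsBipartition ε) (hQ : Q.IsRecurrent ε) (v : V) (x : V → ℝ) :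
    (Q.bigraph ε hε hQ).twoTerm v 1 x = Q.exchange x v := by
  simp only [BipartiteBigraph.twoTerm, bigraph, exchange, one_mul]
  split_ifs
  · rfl
  · exact add_comm _ _

/-- The state with values `exp L` and trivial coefficients. -/
noncomputable def expState (L : V → ℝ) : V ⊕ V → ℝˣ :=
  Sum.elim (fun v => Units.mk0 (Real.exp (L v)) (Real.exp_ne_zero _)) 1

/-- Coefficients equal to `1` remain `1`, so the system with coefficients specializes to the
original T-system. -/
theorem step_expState (hε : Q.IsBipartition ε) (hQ : Q.IsRecurrent ε) (i : Fin 2) (L : V → ℝ) :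
    (Q.bigraph ε hε hQ).step i (fun k => expState L k) =
      fun k => (expState (flip hε.isLocal_logExchange i L) k : ℝ) := by
  ext k
  rcases k with v | v
  · rw [BipartiteBigraph.step_inl]
    simp only [expState, Sum.elim_inl, Units.val_mk0, flip_apply]
    split_ifs
    · rw [Real.exp_sub, exp_logExchange, BipartiteBigraph.first]
      simp [bigraph_twoTerm, div_eq_mul_inv]
    · rfl
  · simp [BipartiteBigraph.step, expState]

theorem alternate_expState (hε : Q.IsBipartition ε) (hQ : Q.IsRecurrent ε) (n : ℕ) (i : Fin 2)
    (L : V → ℝ) : (Q.bigraph ε hε hQ).alternate (2 * n) i (fun k => expState L k) =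
      fun k => (expState (((flip hε.isLocal_logExchange (i + 1) *
        flip hε.isLocal_logExchange i) ^ n) L) k : ℝ) := by
  induction n generalizing L with
  | zero => rfl
  | succ n ih =>
    have hi : i + 1 + 1 = i := by omega
    rw [mul_add, mul_one]
    simp only [BipartiteBigraph.alternate, step_expState, hi, ih, pow_succ]
    rfl

theorem shift_zpow_laurent (hε : Q.IsBipartition ε) (hQ : Q.IsRecurrent ε) (N : ℤ) (v : V) :
    ∃ f ∈ laurentFn (V ⊕ V), ∀ L : V → ℝ,
      Real.exp ((shift hε.isLocal_logExchange ^ N) L v) = f (expState L) := by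
  have hpos : ∀ (L : V → ℝ) k, 0 < (expState L k : ℝ) := by
    rintro L (w | w)
    · exact Real.exp_pos _
    · exact one_pos
  rcases N with n | n
  · obtain ⟨f, hf, e⟩ := (Q.bigraph ε hε hQ).alternate_laurent (2 * n) 0 v
    refine ⟨f, hf, fun L => ?_⟩
    rw [← e _ (hpos L), alternate_expState]
    rfl
  · obtain ⟨f, hf, e⟩ := (Q.bigraph ε hε hQ).alternate_laurent (2 * (n + 1)) 1 v
    refine ⟨f, hf, fun L => ?_⟩
    rw [← e _ (hpos L), alternate_expState, zpow_negSucc, ← inv_pow, shift_inv]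
    rfl

omit [Fintype V] in
theorem expState_update (L : V → ℝ) (u : V) (r : ℝ) : expState (Function.update L u r) =
    Function.update (expState L) (Sum.inl u) (Units.mk0 (Real.exp r) (Real.exp_ne_zero _)) := by
  ext k
  rcases k with v | v
  · rcases eq_or_ne v u with rfl | h
    · simp [expState]
    · simp [expState, h]
  · simp [expState]

/-- As a function of `s = exp r`, the exponential of the left side is a Laurent polynomial of size
at most a constant times `s ^ n` on all of `s > 0`, so it is a constant times `s ^ n`. -/
theorem shift_zpow_update (hε : Q.IsBipartition ε) (hQ : Q.IsRecurrent ε) (N : ℤ) (u v : V)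
    (n : ℕ) (L : V → ℝ)
    (h : ∃ C, ∀ r, |(shift hε.isLocal_logExchange ^ N) (Function.update L u r) v - n * r| ≤ C)
    (r : ℝ) : (shift hε.isLocal_logExchange ^ N) (Function.update L u r) v =
      (shift hε.isLocal_logExchange ^ N) (Function.update L u 0) v + n * r := by
  obtain ⟨f, hf, e⟩ := shift_zpow_laurent hε hQ N v
  obtain ⟨P, m, hP⟩ := exists_polynomial_update hf (expState L) (Sum.inl u)
  obtain ⟨C, hC⟩ := h
  have key : ∀ r, Real.exp ((shift hε.isLocal_logExchange ^ N) (Function.update L u r) v) *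
      Real.exp r ^ m = P.eval (Real.exp r) := fun r => by
    rw [e, expState_update]
    exact hP (Units.mk0 (Real.exp r) (Real.exp_ne_zero r))
  obtain ⟨a, ha⟩ := polynomial_eq_monomial_of_bound (K := Real.exp C) (n + m) P fun s hs => by
    obtain ⟨r, rfl⟩ : ∃ r, Real.exp r = s := ⟨_, Real.exp_log hs⟩
    rw [← key, abs_of_pos (mul_pos (Real.exp_pos _) (pow_pos (Real.exp_pos _) _)), pow_add,
      ← mul_assoc, ← Real.exp_nat_mul r n, ← Real.exp_add]
    refine mul_le_mul_of_nonneg_right (Real.exp_le_exp.2 ?_) (pow_pos (Real.exp_pos _) _).le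
    linarith [(abs_le.1 (hC r)).2]
  have h1 : ∀ r, Real.exp ((shift hε.isLocal_logExchange ^ N) (Function.update L u r) v) =
      a * Real.exp (n * r) := fun r => by
    have h1 := key r
    rw [ha, pow_add, ← mul_assoc] at h1
    rw [mul_right_cancel₀ (pow_pos (Real.exp_pos r) m).ne' h1, ← Real.exp_nat_mul]
  have h0 := h1 0
  rw [mul_zero, Real.exp_zero, mul_one] at h0
  apply Real.exp_injective
  rw [h1, Real.exp_add, h0]

/-! ### From the tropical periodicity at the coordinate vectors to the periodicity -/

theorem shift_zpow_eq_one (hε : Q.IsBipartition ε) (hQ : Q.IsRecurrent ε) {N : ℤ}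
    (h : ∀ u, (shift hε.isLocal_tropicalExchange ^ N) (Pi.single u 1) = Pi.single u 1) :
    shift hε.isLocal_logExchange ^ N = 1 := by
  -- Homogeneity holds for nonnegative factors only, so negative `r` needs the fixed vector
  -- `-Pi.single u 1`.
  have hT : ∀ u r, (shift hε.isLocal_tropicalExchange ^ N) (Pi.single u r) = Pi.single u r := by
    intro u r
    rcases le_total 0 r with hr | hr
    · have := shift_zpow_smul hε.isLocal_tropicalExchange N hr (Pi.single u 1)
      rwa [h, ← Pi.single_smul', smul_eq_mul, mul_one] at this
    · have := shift_zpow_smul hε.isLocal_tropicalExchange N (neg_nonneg.2 hr) (-Pi.single u 1)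
      rwa [shift_zpow_neg_single _ tropicalExchange_zero (h u), smul_neg, neg_smul, neg_neg,
        ← Pi.single_smul', smul_eq_mul, mul_one] at this
  have hupd : ∀ L u r v, (shift hε.isLocal_logExchange ^ N) (Function.update L u r) v =
      (shift hε.isLocal_logExchange ^ N) (Function.update L u 0) v +
        (Pi.single u r : V → ℝ) v := by
    intro L u r v
    obtain ⟨D, hD⟩ := shift_zpow_mem_closePairs
      (flip_mem_closePairs hε.isLocal_logExchange hε.isLocal_tropicalExchange) N (∑ v, |L v|)
    -- The bound is uniform in `r`, since the updated labeling stays within `∑ v, |L v|` of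
    -- `Pi.single u r`.
    have hc : ∀ r, |(shift hε.isLocal_logExchange ^ N) (Function.update L u r) v -
        (Pi.single u r : V → ℝ) v| ≤ D := fun r => by
      have h1 := hD (Function.update L u r) (Pi.single u r) (fun w => ?_) v
      · rwa [hT] at h1
      · rcases eq_or_ne w u with rfl | hw
        · simpa using Finset.sum_nonneg fun v _ => abs_nonneg (L v)
        · simpa [hw] using
            Finset.single_le_sum (fun v _ => abs_nonneg (L v)) (Finset.mem_univ w)
    rcases eq_or_ne v u with rfl | hv
    · simpa using shift_zpow_update hε hQ N v v 1 L ⟨D, by simpa using hc⟩ r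
    · simpa [hv] using shift_zpow_update hε hQ N u v 0 L ⟨D, by simpa [hv] using hc⟩ r
  -- The labeling is built up from `0` one coordinate at a time.
  have hsum : ∀ (s : Finset V) (L : V → ℝ) v,
      (shift hε.isLocal_logExchange ^ N) (∑ u ∈ s, Pi.single u (L u)) v =
        (shift hε.isLocal_logExchange ^ N) 0 v + (∑ u ∈ s, Pi.single u (L u) : V → ℝ) v := by
    intro s L v
    induction s using Finset.induction_on with
    | empty => simp
    | insert u s hu ih =>
      have hz : (∑ u ∈ s, Pi.single u (L u) : V → ℝ) u = 0 := by
        rw [Finset.sum_apply]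
        exact Finset.sum_eq_zero fun w hw =>
          Pi.single_eq_of_ne (fun e => hu (by rwa [e])) _
      have h1 : ∑ u ∈ insert u s, Pi.single u (L u) =
          Function.update (∑ u ∈ s, Pi.single u (L u)) u (L u) := by
        rw [Finset.sum_insert hu]
        ext w
        rcases eq_or_ne w u with rfl | hw
        · simp [hz]
        · simp [hw]
      have h2 : Function.update (∑ u ∈ s, Pi.single u (L u)) u 0 = ∑ u ∈ s, Pi.single u (L u) := by
        rw [← hz, Function.update_eq_self]
      rw [h1, hupd, h2, ih, ← h1, Finset.sum_insert hu, Pi.add_apply]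
      ring
  have hκ : ∀ L v, (shift hε.isLocal_logExchange ^ N) L v =
      L v + (shift hε.isLocal_logExchange ^ N) 0 v := by
    intro L v
    have := hsum Finset.univ L v
    rwa [Finset.univ_sum_single, add_comm] at this
  have hinv : ∀ L v, (shift hε.isLocal_logExchange ^ N)⁻¹ L v =
      L v - (shift hε.isLocal_logExchange ^ N) 0 v := by
    intro L v
    have := hκ ((shift hε.isLocal_logExchange ^ N)⁻¹ L) v
    rw [Equiv.Perm.inv_def, Equiv.apply_symm_apply] at this
    rw [Equiv.Perm.inv_def]
    linarith
  ext L v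
  -- The flip of the opposite colour leaves the label at `v` alone, so the dihedral relation reads
  -- `L v + κ v = L v - κ v`, where `κ` is the image of `0`.
  have h1 := congrFun (shift_zpow_flip hε.isLocal_logExchange N (ε v + 1) L) v
  have hv : ε v ≠ ε v + 1 := by omega
  rw [hκ, flip_apply, flip_apply, if_neg hv, if_neg hv, hinv] at h1
  rw [hκ, Equiv.Perm.one_apply]
  linarith

end ClusterQuiver

namespace ClusterQuiver

variable {V : Type*}

/-! ### Evaluation of rational functions at positive points -/

/-- The rational function `f` is a quotient of two polynomials taking positive values on the
positive orthant, and its value at `exp L` is `exp (h L)`. -/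
def EvalsTo (f : RatFun ℝ V) (h : (V → ℝ) → ℝ) : Prop :=
  ∃ p q : MvPolynomial V ℝ, f = algebraMap _ (RatFun ℝ V) p / algebraMap _ (RatFun ℝ V) q ∧
    ∀ L : V → ℝ, 0 < MvPolynomial.eval (fun v => Real.exp (L v)) q ∧
      MvPolynomial.eval (fun v => Real.exp (L v)) p =
        Real.exp (h L) * MvPolynomial.eval (fun v => Real.exp (L v)) q

theorem algebraMap_ne_zero_of_eval_pos {q : MvPolynomial V ℝ} {x : V → ℝ}
    (h : 0 < MvPolynomial.eval x q) : algebraMap _ (RatFun ℝ V) q ≠ 0 := by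
  intro h0
  have : q = 0 := IsFractionRing.injective (MvPolynomial V ℝ) (RatFun ℝ V) (by simpa using h0)
  simp [this] at h

theorem EvalsTo.indet (v : V) :
    EvalsTo (algebraMap (MvPolynomial V ℝ) (RatFun ℝ V) (MvPolynomial.X v)) fun L => L v :=
  ⟨MvPolynomial.X v, 1, by simp, by simp⟩

theorem EvalsTo.const {c : ℝ} (hc : 0 < c) :
    EvalsTo (const c : RatFun ℝ V) fun _ => Real.log c :=
  ⟨MvPolynomial.C c, 1, by simp [ClusterQuiver.const], by simp [Real.exp_log hc]⟩

theorem EvalsTo.mul {f f' : RatFun ℝ V} {h h' : (V → ℝ) → ℝ} (hf : EvalsTo f h)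
    (hf' : EvalsTo f' h') : EvalsTo (f * f') fun L => h L + h' L := by
  obtain ⟨p, q, rfl, e⟩ := hf
  obtain ⟨p', q', rfl, e'⟩ := hf'
  refine ⟨p * p', q * q', by rw [map_mul, map_mul, div_mul_div_comm], fun L => ⟨?_, ?_⟩⟩
  · rw [map_mul]
    exact mul_pos (e L).1 (e' L).1
  · rw [map_mul, map_mul, (e L).2, (e' L).2, Real.exp_add]
    ring

theorem EvalsTo.div {f f' : RatFun ℝ V} {h h' : (V → ℝ) → ℝ} (hf : EvalsTo f h)
    (hf' : EvalsTo f' h') : EvalsTo (f / f') fun L => h L - h' L := by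
  obtain ⟨p, q, rfl, e⟩ := hf
  obtain ⟨p', q', rfl, e'⟩ := hf'
  refine ⟨p * q', q * p', by rw [map_mul, map_mul, div_div_div_eq], fun L => ⟨?_, ?_⟩⟩
  · rw [map_mul, (e' L).2]
    exact mul_pos (e L).1 (mul_pos (Real.exp_pos _) (e' L).1)
  · have := Real.exp_ne_zero (h' L)
    rw [map_mul, map_mul, (e L).2, (e' L).2, Real.exp_sub]
    field_simp

theorem EvalsTo.add {f f' : RatFun ℝ V} {h h' : (V → ℝ) → ℝ} (hf : EvalsTo f h)
    (hf' : EvalsTo f' h') :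
    EvalsTo (f + f') fun L => Real.log (Real.exp (h L) + Real.exp (h' L)) := by
  obtain ⟨p, q, rfl, e⟩ := hf
  obtain ⟨p', q', rfl, e'⟩ := hf'
  refine ⟨p * q' + q * p', q * q', ?_, fun L => ⟨?_, ?_⟩⟩
  · rw [div_add_div _ _ (algebraMap_ne_zero_of_eval_pos (e 0).1)
      (algebraMap_ne_zero_of_eval_pos (e' 0).1)]
    simp
  · rw [map_mul]
    exact mul_pos (e L).1 (e' L).1
  · rw [Real.exp_log (add_pos (Real.exp_pos _) (Real.exp_pos _)), map_add, map_mul, map_mul,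
      map_mul, (e L).2, (e' L).2]
    ring

theorem EvalsTo.pow {f : RatFun ℝ V} {h : (V → ℝ) → ℝ} (hf : EvalsTo f h) (n : ℕ) :
    EvalsTo (f ^ n) fun L => n * h L := by
  induction n with
  | zero => exact ⟨1, 1, by simp, by simp⟩
  | succ n ih =>
    rw [pow_succ]
    convert ih.mul hf using 2 with L
    push_cast
    ring

theorem EvalsTo.prod_pow {κ : Type*} (s : Finset κ) {f : κ → RatFun ℝ V}
    {h : κ → (V → ℝ) → ℝ} (hf : ∀ k, EvalsTo (f k) (h k)) (n : κ → ℕ) :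
    EvalsTo (∏ k ∈ s, f k ^ n k) fun L => ∑ k ∈ s, (n k : ℝ) * h k L := by
  classical
  induction s using Finset.induction_on with
  | empty => exact ⟨1, 1, by simp, by simp⟩
  | insert k s hk ih =>
    simp only [Finset.prod_insert hk, Finset.sum_insert hk]
    exact ((hf k).pow _).mul ih

/-- The points `exp L` fill the positive orthant, and values there determine a rational function. -/
theorem EvalsTo.eval_eq [Finite V] {f g : RatFun ℝ V} {h h' : (V → ℝ) → ℝ} (hf : EvalsTo f h)
    (hg : EvalsTo g h') : f = g ↔ h = h' := by
  obtain ⟨p, q, rfl, e⟩ := hf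
  obtain ⟨p', q', rfl, e'⟩ := hg
  rw [div_eq_div_iff (algebraMap_ne_zero_of_eval_pos (e 0).1)
    (algebraMap_ne_zero_of_eval_pos (e' 0).1), ← map_mul, ← map_mul,
    (IsFractionRing.injective (MvPolynomial V ℝ) (RatFun ℝ V)).eq_iff]
  constructor
  · intro H
    ext L
    have := congrArg (MvPolynomial.eval fun v => Real.exp (L v)) H
    rw [map_mul, map_mul, (e L).2, (e' L).2] at this
    have h1 : Real.exp (h L) = Real.exp (h' L) := by
      refine mul_right_cancel₀ (mul_pos (e L).1 (e' L).1).ne' ?_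
      linear_combination this
    exact Real.exp_injective h1
  · rintro rfl
    refine MvPolynomial.eq_of_eval_pos fun x hx => ?_
    have hL : x = fun v => Real.exp (Real.log (x v)) := funext fun v => (Real.exp_log (hx v)).symm
    rw [hL, map_mul, map_mul, (e _).2, (e' _).2]
    ring

theorem toReal_indet (v : V) :
    toReal (indet v) = algebraMap (MvPolynomial V ℝ) (RatFun ℝ V) (MvPolynomial.X v) := by
  simp [toReal, indet, IsFractionRing.map]

variable [Fintype V] {Q : ClusterQuiver V} {ε : V → Fin 2}

theorem EvalsTo.exchange_div {x : V → RatFun ℝ V} {h : V → (V → ℝ) → ℝ}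
    (hx : ∀ v, EvalsTo (x v) (h v)) (v : V) : EvalsTo (Q.exchange x v / x v)
      fun L => Q.logExchange (fun w => h w L) v - h v L := by
  simp only [logExchange, exchange_exp]
  exact ((EvalsTo.prod_pow _ hx _).add (EvalsTo.prod_pow _ hx _)).div (hx v)

theorem evalsTo_tSystem (v : V) (t : ℤ) : EvalsTo (toReal (Q.tSystem ε v t))
    fun L => labelAt ε (fun L v => Q.logExchange L v - L v) L t v := by
  have h1 : EvalsTo (toReal (Q.tSystem ε v t)) (labelAt ε
      (fun (H : V → (V → ℝ) → ℝ) v L => Q.logExchange (fun w => H w L) v - H v L)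
      (fun v L => L v) t v) := by
    refine labelAt_rel (fun f h => EvalsTo (toReal f) h) (fun x h hx v => ?_) (fun v => ?_) t v
    · have := EvalsTo.exchange_div (Q := Q) hx v
      simpa [exchange] using this
    · rw [toReal_indet]
      exact EvalsTo.indet v
  -- The recurrence run on functions of `L` and then evaluated agrees with the recurrence run on the
  -- labeling `L`.
  convert h1 using 2 with L
  refine labelAt_rel (f := fun L v => Q.logExchange L v - L v)
    (g := fun (H : V → (V → ℝ) → ℝ) v L => Q.logExchange (fun w => H w L) v - H v L) (x := L)
    (y := fun v L => L v) (fun a h => a = h L) (fun x h hx v => ?_) (fun v => rfl) t v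
  obtain rfl : x = fun w => h w L := funext hx
  rfl

/-! ### Consequences of birational periodicity -/

/-- On the ray through `l` the two systems start from the same labeling `s • l`, so the displacement
of the tropical power is bounded in `s`. By homogeneity it is also proportional to `s`, hence zero.
-/
theorem tropical_shift_eq_of_log_shift_eq (hε : Q.IsBipartition ε) {N : ℤ} {κ : V → ℝ}
    (h : ∀ L v, (shift hε.isLocal_logExchange ^ N) L v = κ v + L v) (l : V → ℝ) :
    (shift hε.isLocal_tropicalExchange ^ N) l = l := by
  obtain ⟨D, hD⟩ := shift_zpow_mem_closePairs
    (flip_mem_closePairs hε.isLocal_logExchange hε.isLocal_tropicalExchange) N 0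
  ext v
  have hb : ∀ s : ℝ, 0 ≤ s →
      |s * (l v - (shift hε.isLocal_tropicalExchange ^ N) l v)| ≤ D + |κ v| := fun s hs => by
    have h1 := hD (s • l) (s • l) (by simp) v
    simp only [shift_zpow_smul _ N hs, h, Pi.smul_apply, smul_eq_mul] at h1
    have h2 := abs_sub_abs_le_abs_sub
      (s * (l v - (shift hε.isLocal_tropicalExchange ^ N) l v)) (-κ v)
    rw [abs_neg] at h2
    have h3 : s * (l v - (shift hε.isLocal_tropicalExchange ^ N) l v) - -κ v =
      κ v + s * l v - s * (shift hε.isLocal_tropicalExchange ^ N) l v := by ring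
    rw [h3] at h2
    linarith
  by_contra hne
  have hpos : 0 < |l v - (shift hε.isLocal_tropicalExchange ^ N) l v| :=
    abs_pos.2 (sub_ne_zero.2 (Ne.symm hne))
  have h0 : 0 ≤ D + |κ v| := by simpa using hb 0 le_rfl
  -- This value of `s` makes the displacement exceed the bound by `1`.
  have := hb ((D + |κ v| + 1) / |l v - (shift hε.isLocal_tropicalExchange ^ N) l v|) (by positivity)
  rw [abs_mul, abs_div, abs_abs, div_mul_cancel₀ _ hpos.ne'] at this
  linarith [le_abs_self (D + |κ v| + 1)]

theorem log_shift_eq_of_tSystem (hε : Q.IsBipartition ε) {N : ℤ} {c : V → ℝ} (hc : ∀ v, 0 < c v)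
    (h : ∀ (v : V) (t : ℤ), Even (t + eps ε v) →
      toReal (Q.tSystem ε v (t + 2 * N)) = const (c v) * toReal (Q.tSystem ε v t))
    (L : V → ℝ) (v : V) :
    (shift hε.isLocal_logExchange ^ N) L v = Real.log (c v) + L v := by
  have h1 := congrFun (((evalsTo_tSystem v _).eval_eq
    ((EvalsTo.const (hc v)).mul (evalsTo_tSystem v _))).1 (h v (eps ε v) ⟨_, rfl⟩)) L
  have h2 := labelAt_eps_add hε.isLocal_logExchange L 0 v
  rw [mul_zero, add_zero, zpow_zero, Equiv.Perm.one_apply] at h2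
  rw [← labelAt_eps_add hε.isLocal_logExchange L N v, h1, h2]

/-- The defining equation says that the exchange term at `log ρ` is twice the label, so `E L v - L v
= L v` and each flip fixes `log ρ`. -/
theorem IsFixedPoint.shift_zpow (hε : Q.IsBipartition ε) {ρ : V → ℝ} (hρ : Q.IsFixedPoint ρ)
    (N : ℤ) : (shift hε.isLocal_logExchange ^ N) (fun v => Real.log (ρ v)) =
      fun v => Real.log (ρ v) := by
  have hflip : ∀ i, flip hε.isLocal_logExchange i (fun v => Real.log (ρ v)) =
      fun v => Real.log (ρ v) := fun i => by
    ext v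
    have h : Q.logExchange (fun v => Real.log (ρ v)) v = 2 * Real.log (ρ v) := by
      simp only [logExchange, Real.exp_log (one_pos.trans (hρ.1 _))]
      rw [← hρ.2, Real.log_pow, Nat.cast_ofNat]
    rw [flip_apply, h]
    split_ifs
    · ring
    · rfl
  refine Equiv.Perm.zpow_apply_eq_self_of_apply_eq_self ?_ N
  rw [shift, Equiv.Perm.mul_apply, hflip, hflip]

end ClusterQuiver

theorem mainTheorem6 {V : Type*} [Fintype V] [DecidableEq V] (Q : ClusterQuiver V)
    (ε : V → Fin 2) (hε : Q.IsBipartition ε) (hQ : Q.IsRecurrent ε) (N : ℤ) :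
    List.TFAE [
      ∀ u v : V,
        Q.tropicalTSystem ε (Pi.single u 1) v (ClusterQuiver.eps ε v + 2 * N) =
          Q.tropicalTSystem ε (Pi.single u 1) v (ClusterQuiver.eps ε v),
      ∀ (l : V → ℝ) (v : V) (t : ℤ), Even (t + ClusterQuiver.eps ε v) →
        Q.tropicalTSystem ε l v (t + 2 * N) = Q.tropicalTSystem ε l v t,
      ∃ c : V → ℝ, (∀ v, 0 < c v) ∧
        ∀ (v : V) (t : ℤ), Even (t + ClusterQuiver.eps ε v) →
          ClusterQuiver.toReal (Q.tSystem ε v (t + 2 * N)) =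
            ClusterQuiver.const (c v) * ClusterQuiver.toReal (Q.tSystem ε v t)] ∧
    ∀ c : V → ℝ, (∀ v, 0 < c v) →
      (∀ (v : V) (t : ℤ), Even (t + ClusterQuiver.eps ε v) →
        ClusterQuiver.toReal (Q.tSystem ε v (t + 2 * N)) =
          ClusterQuiver.const (c v) * ClusterQuiver.toReal (Q.tSystem ε v t)) →
      (∃ ρ : V → ℝ, Q.IsFixedPoint ρ) → ∀ v, c v = 1 := by
  refine ⟨?_, fun c hc h ⟨ρ, hρ⟩ v => ?_⟩
  · tfae_have 2 → 1 := fun h u v => h _ v _ ⟨_, rfl⟩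
    tfae_have 3 → 2 := by
      rintro ⟨c, hc, h⟩ l v t -
      exact congrFun (ClusterQuiver.labelAt_periodic hε.isLocal_tropicalExchange
        (ClusterQuiver.tropical_shift_eq_of_log_shift_eq hε
          (ClusterQuiver.log_shift_eq_of_tSystem hε hc h) l) t) v
    tfae_have 1 → 3 := by
      intro h
      have h1 : ClusterQuiver.shift hε.isLocal_logExchange ^ N = 1 := by
        refine ClusterQuiver.shift_zpow_eq_one hε hQ fun u => funext fun v => ?_
        rw [← ClusterQuiver.labelAt_eps_add]
        exact (h u v).trans (ClusterQuiver.tropicalTSystem_init Q ε _ v)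
      -- The logarithmic power is exactly the identity, so the constants can be taken to be `1`.
      refine ⟨1, fun v => one_pos, fun v t _ => ?_⟩
      have hc : (ClusterQuiver.const 1 : ClusterQuiver.RatFun ℝ V) = 1 := by
        simp [ClusterQuiver.const]
      rw [Pi.one_apply, hc, one_mul, (ClusterQuiver.evalsTo_tSystem v _).eval_eq
        (ClusterQuiver.evalsTo_tSystem v _)]
      ext L
      rw [ClusterQuiver.labelAt_periodic hε.isLocal_logExchange
        (by rw [h1, Equiv.Perm.one_apply])]
    tfae_finish
  · have h1 := ClusterQuiver.log_shift_eq_of_tSystem hε hc h (fun v => Real.log (ρ v)) v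
    rw [hρ.shift_zpow hε N] at h1
    exact Real.eq_one_of_pos_of_log_eq_zero (hc v) (by linarith)
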